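/- **Setting.** Let $n,d\ge 1$, let $D\subset\mathbb R^d$ be convex and compact with nonempty interior, let $X\subseteq D$ be nonempty, closed and convex, let $\overline u>0$ and $0<\alpha<\beta$, and let $\mathcal S\subset L_2(D)$ be the set of $h\in C^2(D)$ with $|\nabla h|\le\overline u$ on $D$ and $\alpha I_d\le\nabla^2h\le\beta I_d$ on the interior of $D$. Let $\overline{\mathcal S}$ be the closure of $\mathcal S$ in $L_2(D)$; its elements are evaluated through their continuous representatives. Let $f_1,\dots,f_n\in\mathcal S$. Let $\{e_k\}_{k\ge1}$ be an orthonormal basis of $L_2(D)$ and $\Phi(\theta)=\sum_k\theta_ke_k$ for $\theta\in\ell_2$. For $i\in\{1,\dots,n\}$ let $q_i>1$, $\gamma_i>0$, $p_i\in(\frac12,q_i-\frac12)$, $\varepsilon_i>0$, and let $\eta_{i,k}$ ($i\le n$, $k\ge 1$) be independent random variables, $\eta_{i,k}$ having the Laplace density $\frac1{2b}e^{-|x|/b}$ with scale $b=\gamma_i/k^{p_i}$. Given objective functions $F=(F_1,\dots,F_n)\in L_2(D)^n$, agent $i$ forms $\hat F_i=F_i+\Phi(\eta_i)$, smooths it to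 $\hat F_i^s=s_i(\hat F_i)$, where $s_i:L_2(D)\to L_2(D)$ is a measurable map with $s_i(g)\in C^2(D)$ and $\|g-s_i(g)\|<\varepsilon_i$ for all $g$, and projects: $\tilde F_i=\mathrm{proj}_{\overline{\mathcal S}}(\hat F_i^s)$ (the projection onto $\mathcal S$ itself whenever that exists). Starting from some initial states, the agents then run a distributed algorithm over a digraph (each agent updates its state from its own function $\tilde F_i$, its state and the messages of its in-neighbors, all maps being measurable). Assume that for $F=(f_1,\dots,f_n)$ the estimates of all agents almost surely converge to the minimizer $\tilde x^*$ of $\sum_i\tilde f_i$ over $X$. A random map $\mathcal M$ on $L_2(D)^n$ is $(\epsilon_1,\dots,\epsilon_n)$-differentially private if, whenever $F,F'$ differ at most in entry $i_0$ and $\delta_k=\langle F_{i_0}-F'_{i_0},e_k\rangle$ satisfies $N:=\big(\sum_k(k^{q_{i_0}}\delta_k)^2\big)^{1/2}<\infty$, one has $\mathbb P\{\mathcal M(F')\in\mathcal O\}\le e^{\epsilon_{i_0}N}\,\mathbb P\{\mathcal M(F)\in\mathcal O\}$ for all measurable $\mathcal O$. **Modulus.** Let $r_D$ and $d_D$ be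 the inradius and the diameter of $D$, and $\lambda_D\in(0,1)$ any constant with $m(B(x,r)\cap D)\ge\lambda_D\,m(B(x,r))$ for all $x\in D$ and $r\le r_D$, where $m$ is Lebesgue measure (such constants exist). For $r\ge0$ put $$\mu_{\alpha,\beta}(r)=\frac{\alpha r^2}{2\sqrt{\alpha\beta r^2+2(\beta+\alpha)\overline u r+4\overline u^2}},\qquad \kappa_{\alpha,\beta}^{-1}(r)=\left(\frac{\alpha^2\pi^{d/2}}{d\,2^{d+3}\,\Gamma(d/2)}\,\lambda_D\Big(\frac{r_D}{d_D}\Big)^d r^4\mu_{\alpha,\beta}(r)^d\right)^{1/2},$$ and $\kappa_n=\kappa_{n\alpha,n\beta}$ (with the same $\overline u$). **Theorem.** Almost surely $\eta_i\in\ell_2$ for all $i$. The map $F\mapsto(\tilde F_1,\dots,\tilde F_n)$, and, for all initial states, the map from $F$ to the whole sequence of messages exchanged by the algorithm run on $(\tilde F_i)_i$, are $(\epsilon_1,\dots,\epsilon_n)$-differentially private with $\epsilon_i=\sqrt{\zeta(2(q_i-p_i))}/\gamma_i$. Moreover $\sum_if_i$ has a unique minimizer $x^*$ over $X$, almost surely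 $\sum_i\tilde f_i$ has a unique minimizer $\tilde x^*$ over $X$ (the limit of the agents' estimates), $\kappa_n$ is a well-defined strictly increasing continuous bijection of $[0,\infty)$, and $$\mathbb E\,|\tilde x^*-x^*|\le\sum_{i=1}^n\Big(\kappa_n\big(\gamma_i\sqrt{\zeta(2p_i)}\big)+\kappa_n(\varepsilon_i)\Big).$$ -/

import Mathlib

open MeasureTheory ProbabilityTheory Filter Topology
open scoped ENNReal

noncomputable section

namespace PrivOpt

/-- Euclidean space `ℝ^d`. -/
abbrev E (d : ℕ) := EuclideanSpace ℝ (Fin d)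

/-- The Hilbert space `L₂(D)` (Lebesgue measure on `D`). -/
abbrev L2 {d : ℕ} (D : Set (E d)) := Lp ℝ 2 ((volume : Measure (E d)).restrict D)

/-- `L₂(D)` carries its Borel σ-algebra. -/
instance instMeasurableSpaceL2 {d : ℕ} (D : Set (E d)) : MeasurableSpace (L2 D) := borel (L2 D)

instance instBorelSpaceL2 {d : ℕ} (D : Set (E d)) : BorelSpace (L2 D) := ⟨rfl⟩

/-! ### Function classes -/

/-- `C²(D)` as a subset of `L₂(D)`. -/
def C2Class {d : ℕ} (D : Set (E d)) : Set (L2 D) :=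
  {g | ∃ h : E d → ℝ, ContDiffOn ℝ 2 h D ∧ g =ᵐ[(volume : Measure (E d)).restrict D] h}

/-- `h ∈ C²(D)`, the gradient of `h` is bounded by `u` on `D`, and
`α I ≤ ∇²h ≤ β I` on the interior of `D`. -/
def IsRegular {d : ℕ} (D : Set (E d)) (u α β : ℝ) (h : E d → ℝ) : Prop :=
  ContDiffOn ℝ 2 h D ∧
  (∀ x ∈ D, ‖fderivWithin ℝ h D x‖ ≤ u) ∧
  ∀ x ∈ interior D, ∀ v : E d,
    α * ‖v‖ ^ 2 ≤ fderiv ℝ (fderiv ℝ h) x v v ∧ fderiv ℝ (fderiv ℝ h) x v v ≤ β * ‖v‖ ^ 2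

/-- The set `𝒮` as a subset of `L₂(D)`. -/
def SClass {d : ℕ} (D : Set (E d)) (u α β : ℝ) : Set (L2 D) :=
  {g | ∃ h : E d → ℝ, IsRegular D u α β h ∧ g =ᵐ[(volume : Measure (E d)).restrict D] h}

/-- Orthogonal (nearest point) projection onto a subset `K` of a normed space. It is the
usual one when `K` is a nonempty closed convex subset of a Hilbert space. -/
def proj {H : Type*} [NormedAddCommGroup H] (K : Set H) (h : H) : H :=
  Classical.epsilon fun v => v ∈ K ∧ ∀ w ∈ K, ‖h - v‖ ≤ ‖h - w‖

/-- `x` is the unique minimizer over `X` of the sum of the functions `g i ∈ L₂(D)`, each of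
which is evaluated through its continuous representative on `D` (which has to exist). -/
def IsArgmin {d n : ℕ} (D X : Set (E d)) (g : Fin n → L2 D) (x : E d) : Prop :=
  ∃ h : Fin n → E d → ℝ,
    (∀ i, ContinuousOn (h i) D ∧ g i =ᵐ[(volume : Measure (E d)).restrict D] h i) ∧
    x ∈ X ∧ ∀ y ∈ X, y ≠ x → ∑ i, h i x < ∑ i, h i y

/-! ### Laplace noise and functional perturbation -/

/-- The zero-mean Laplace distribution with scale `b`. -/
def laplace (b : ℝ) : Measure ℝ :=
  volume.withDensity fun x => ENNReal.ofReal (1 / (2 * b) * Real.exp (-|x| / b))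

/-- `Φ`: the function with coefficient sequence `c` in the basis `e`
(the value `0` when `c` is not square summable is irrelevant). -/
def Phi {d : ℕ} {D : Set (E d)} (e : HilbertBasis ℕ ℝ (L2 D)) (c : ℕ → ℝ) : L2 D :=
  open Classical in
  if hc : Memℓp c 2 then e.repr.symm ⟨c, hc⟩ else 0

/-- The functions `f̃ i` used by the agents: perturb `F i` by `Φ (c i)`, smooth the result by
`s i`, and project onto the closure `S̄` of `𝒮` in `L₂(D)`. -/
def perturbed {d n : ℕ} {D : Set (E d)} (u α β : ℝ) (e : HilbertBasis ℕ ℝ (L2 D))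
    (s : Fin n → L2 D → L2 D) (F : Fin n → L2 D) (c : Fin n → ℕ → ℝ) : Fin n → L2 D :=
  fun i => proj (closure (SClass D u α β)) (s i (F i + Phi e (c i)))

/-! ### Differential privacy -/

/-- The adjacency space `𝒱_q`. The `k`-th weight is `(k+1)^q` as indices start from `0`. -/
def adjSpace {d : ℕ} {D : Set (E d)} (e : HilbertBasis ℕ ℝ (L2 D)) (q : ℝ) : Set (L2 D) :=
  {g | Summable fun k : ℕ => (((k : ℝ) + 1) ^ q * e.repr g k) ^ 2}

/-- The norm of `𝒱_q`. -/
def adjNorm {d : ℕ} {D : Set (E d)} (e : HilbertBasis ℕ ℝ (L2 D)) (q : ℝ) (g : L2 D) : ℝ :=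
  Real.sqrt (∑' k : ℕ, (((k : ℝ) + 1) ^ q * e.repr g k) ^ 2)

/-- `ε`-differential privacy of the random map `M`, where the adjacency space for agent `i`
is `𝒱_{q i}`. -/
def IsDiffPrivate {d n : ℕ} {D : Set (E d)} (e : HilbertBasis ℕ ℝ (L2 D)) (q : Fin n → ℝ)
    {Ω : Type*} [MeasurableSpace Ω] (P : Measure Ω) {Y : Type*} [MeasurableSpace Y]
    (M : (Fin n → L2 D) → Ω → Y) (ε : Fin n → ℝ) : Prop :=
  ∀ (F F' : Fin n → L2 D) (i₀ : Fin n), (∀ i, i ≠ i₀ → F i = F' i) →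
    F i₀ - F' i₀ ∈ adjSpace e (q i₀) →
    ∀ O : Set Y, MeasurableSet O →
      P {ω | M F' ω ∈ O} ≤
        ENNReal.ofReal (Real.exp (ε i₀ * adjNorm e (q i₀) (F i₀ - F' i₀))) * P {ω | M F ω ∈ O}

/-! ### Distributed algorithms -/

/-- A distributed coordination algorithm over the digraph `G`. At round `k`, agent `i`
broadcasts a message computed from its own objective function and state, then updates its
state from its own function, its state and the messages of its in-neighbors. Each agent
reads an estimate of the optimizer off its state. -/
structure DistAlg {d n : ℕ} (D : Set (E d)) (G : Digraph (Fin n)) (State Msg : Type*)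
    [MeasurableSpace State] [MeasurableSpace Msg] where
  send : ℕ → Fin n → L2 D → State → Msg
  update : ℕ → (i : Fin n) → L2 D → State → ({j : Fin n // G.Adj j i} → Msg) → State
  estimate : Fin n → State → E d
  measurable_send : ∀ k i, Measurable fun z : L2 D × State => send k i z.1 z.2
  measurable_update : ∀ k i, Measurable
    fun z : L2 D × State × ({j : Fin n // G.Adj j i} → Msg) => update k i z.1 z.2.1 z.2.2
  measurable_estimate : ∀ i, Measurable (estimate i)

namespace DistAlg

variable {d n : ℕ} {D : Set (E d)} {G : Digraph (Fin n)} {State Msg : Type*}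
  [MeasurableSpace State] [MeasurableSpace Msg]

/-- The states of the agents at each time, from the initial states `z`, when agent `i` uses the
objective function `g i`. -/
def run (A : DistAlg D G State Msg) (z : Fin n → State) (g : Fin n → L2 D) :
    ℕ → Fin n → State
  | 0 => z
  | k + 1 => fun i => A.update k i (g i) (run A z g k i)
      fun j => A.send k j.1 (g j.1) (run A z g k j.1)

/-- The whole sequence of messages transmitted over the network. -/
def transcript (A : DistAlg D G State Msg) (z : Fin n → State) (g : Fin n → L2 D) :
    ℕ → Fin n → Msg :=
  fun k i => A.send k i (g i) (A.run z g k i)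

end DistAlg

/-! ### The modulus of the argmin map -/

/-- Class `𝒦_∞` (functions on `[0, ∞)`). -/
def IsKInf (κ : ℝ → ℝ) : Prop :=
  StrictMonoOn κ (Set.Ici 0) ∧ ContinuousOn κ (Set.Ici 0) ∧ κ 0 = 0 ∧ Tendsto κ atTop atTop

/-- The inradius of `D`. -/
def inradius {d : ℕ} (D : Set (E d)) : ℝ :=
  sSup {r : ℝ | 0 ≤ r ∧ ∃ c, Metric.closedBall c r ⊆ D}

/-- `lam ∈ (0,1)` is a constant `λ_D`: it bounds below the portion in `D` of any ball centered
in `D` with radius at most the inradius. -/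
def IsPortionConst {d : ℕ} (D : Set (E d)) (lam : ℝ) : Prop :=
  0 < lam ∧ lam < 1 ∧ ∀ x ∈ D, ∀ r : ℝ, r ≤ inradius D →
    lam * volume.real (Metric.closedBall x r) ≤ volume.real (Metric.closedBall x r ∩ D)

/-- The function `μ_{α,β}`. -/
def mu (α β u r : ℝ) : ℝ :=
  α * r ^ 2 / (2 * Real.sqrt (α * β * r ^ 2 + 2 * (β + α) * u * r + 4 * u ^ 2))

/-- The function `κ_{α,β}⁻¹`. -/
def kappaInv {d : ℕ} (D : Set (E d)) (lam u α β r : ℝ) : ℝ :=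
  Real.sqrt (α ^ 2 * Real.pi ^ ((d : ℝ) / 2) / (d * 2 ^ (d + 3) * Real.Gamma ((d : ℝ) / 2)) * lam *
    (inradius D / Metric.diam D) ^ d * r ^ 4 * mu α β u r ^ d)

/-- The function `κ_{α,β}` on `[0, ∞)`. -/
def kappa {d : ℕ} (D : Set (E d)) (lam u α β : ℝ) : ℝ → ℝ :=
  Function.invFunOn (kappaInv D lam u α β) (Set.Ici 0)

end PrivOpt

end

/-! Privacy. Changing entry `i₀` of `F` has the same effect as shifting the noise of agent `i₀` by
the coefficients `δ k` of the change (`perturbed_shift`). Shifting a Laplace law of scale `b` by `δ`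
costs a factor at most `e^{|δ|/b}` (`laplace_map_sub_le`). By independence these factors multiply
(`infinitePi_le_smul`), and Cauchy–Schwarz bounds the total exponent by `√ζ(2(q-p))/γ` times the
adjacency norm (`sum_div_scale_le`). Smoothing, projection and the algorithm are measurable
post-processing of the noisy functions; the projection is measurable because it is nonexpansive.

Accuracy. Elements of the closure of `𝒮` have representatives that are `u`-Lipschitz and
`α`-strongly convex (`closure_SClass_subset`). Let two sums of `n` such functions differ in one
summand and have minimizers at distance `r`. Quadratic growth of both sums forces the differing
summands to be at least `nαr²/2` apart at one of the two minimizers (`exists_large_difference`).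
Their difference is `2u`-Lipschitz, hence still large on a small ball, a definite portion of which
lies in `D`. This bounds the squared `L₂` norm below by `2 κₙ⁻¹(r)²` (`two_mul_kappaInv_sq_le`).
Exchanging the summands one at a time gives `exists_argmin_selection`.

Nonexpansiveness gives `‖f̃ᵢ - fᵢ‖ ≤ ‖Φ(ηᵢ)‖ + εᵢ`. As `κₙ` is subadditive, the two errors separate,
and Jensen's inequality for the convex function `(κₙ⁻¹)²` turns `E‖Φ(ηᵢ)‖² = 2γᵢ²ζ(2pᵢ)` into the
noise term (`kappa_integral_le`). The 2 of the Laplace variance is absorbed by the 2 in the lower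
bound. -/

namespace PrivOpt

/-! ### Domination of product measures, finite and infinite. -/

section ProductComparison

/-- A product measure comes from the largest outer measure bounded on boxes by the product of the
factors, so comparing on boxes suffices. -/
theorem pi_le_smul_pi {ι : Type*} [Fintype ι] {X : ι → Type*} [∀ i, MeasurableSpace (X i)]
    (μ ν : ∀ i, Measure (X i)) [∀ i, IsFiniteMeasure (μ i)] [∀ i, IsFiniteMeasure (ν i)]
    (C : ι → NNReal) (h : ∀ i, ν i ≤ C i • μ i) :
    Measure.pi ν ≤ (∏ i, C i) • Measure.pi μ := by
  have h1 : Measure.pi (fun i => C i • μ i) = (∏ i, C i) • Measure.pi μ := by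
    refine Measure.pi_eq fun s _ => ?_
    simp only [Measure.smul_apply, Measure.pi_pi, ENNReal.smul_def, smul_eq_mul,
      ENNReal.ofNNReal_finsetProd, Finset.prod_mul_distrib]
  rw [← h1]
  have h2 : (Measure.pi ν).toOuterMeasure ≤
      OuterMeasure.pi fun i => (C i • μ i).toOuterMeasure := by
    rw [OuterMeasure.le_pi]
    intro s _
    change Measure.pi ν _ ≤ _
    rw [Measure.pi_pi]
    exact Finset.prod_le_prod' fun i _ => h i (s i)
  refine Measure.le_iff.2 fun s hs => ?_
  rw [Measure.pi_def (fun i => C i • μ i), toMeasure_apply _ _ hs]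
  exact h2 s

theorem measure_le_of_isSetRing {X : Type*} {m : MeasurableSpace X} (μ ν : Measure X)
    [IsFiniteMeasure μ] [IsFiniteMeasure ν] {R : Set (Set X)} (hR : IsSetRing R)
    (huniv : Set.univ ∈ R) (hgen : m = MeasurableSpace.generateFrom R)
    (h : ∀ s ∈ R, ν s ≤ μ s) : ν ≤ μ := by
  refine Measure.le_iff.2 fun s hs => ?_
  refine ENNReal.le_of_forall_pos_le_add fun ε hε _ => ?_
  have hε2 : (0 : ℝ≥0∞) < ε / 2 := by
    simp only [ENNReal.div_pos_iff]
    exact ⟨by exact_mod_cast hε.ne', by simp⟩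
  -- Approximating with respect to `μ + ν` makes the error small for both measures at once.
  obtain ⟨t, htR, ht⟩ := exists_measure_symmDiff_lt_of_generateFrom_isSetRing (μ := μ + ν) hR
    ⟨{Set.univ}, Set.countable_singleton _, by simpa using huniv, by simp⟩ hgen hs hε2
  have hμ : μ (symmDiff t s) ≤ ε / 2 := le_trans (by simp [Measure.add_apply]) ht.le
  have hν : ν (symmDiff t s) ≤ ε / 2 := le_trans (by simp [Measure.add_apply]) ht.le
  have e1 : ν s ≤ ν t + ν (symmDiff t s) := by
    refine (measure_mono fun x hx => ?_).trans (measure_union_le _ _)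
    by_cases hxt : x ∈ t
    · exact Or.inl hxt
    · exact Or.inr (Or.inr ⟨hx, hxt⟩)
  have e2 : μ t ≤ μ s + μ (symmDiff t s) := by
    refine (measure_mono fun x hx => ?_).trans (measure_union_le _ _)
    by_cases hxs : x ∈ s
    · exact Or.inl hxs
    · exact Or.inr (Or.inl ⟨hx, hxs⟩)
  calc ν s ≤ μ t + ε / 2 := e1.trans (add_le_add (h t htR) hν)
    _ ≤ μ s + ε / 2 + ε / 2 := by gcongr; exact e2.trans (by gcongr)
    _ = μ s + ε := by rw [add_assoc, ENNReal.add_halves]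

/-- A cylinder involves finitely many coordinates; a bound on the partial products uniform in `I`
therefore passes to the ring of cylinders, and from there to the generated σ-algebra. -/
theorem infinitePi_le_smul {ι : Type*} {X : ι → Type*} [∀ i, MeasurableSpace (X i)]
    (μ ν : ∀ i, Measure (X i)) [∀ i, IsProbabilityMeasure (μ i)]
    [∀ i, IsProbabilityMeasure (ν i)] (C : ι → NNReal) (K : NNReal)
    (h : ∀ i, ν i ≤ C i • μ i) (hK : ∀ I : Finset ι, ∏ i ∈ I, C i ≤ K) :
    Measure.infinitePi ν ≤ K • Measure.infinitePi μ := by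
  refine measure_le_of_isSetRing _ _ isSetRing_measurableCylinders (univ_mem_measurableCylinders _)
    generateFrom_measurableCylinders.symm ?_
  intro s hs
  obtain ⟨I, S, mS, rfl⟩ := (mem_measurableCylinders s).1 hs
  rw [Measure.smul_apply, cylinder, ← Measure.map_apply (Finset.measurable_restrict _) mS,
    ← Measure.map_apply (Finset.measurable_restrict _) mS, Measure.infinitePi_map_restrict,
    Measure.infinitePi_map_restrict]
  refine (pi_le_smul_pi (fun i : I => μ i) (fun i : I => ν i) (fun i => C i)
    (fun i => h i) S).trans ?_
  rw [Measure.smul_apply, ENNReal.smul_def, ENNReal.smul_def, smul_eq_mul, smul_eq_mul]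
  gcongr
  have := hK I
  rwa [← Finset.prod_coe_sort] at this

end ProductComparison

/-! ### The Laplace law: cost of a shift, second moment. -/

section Laplace

theorem measurable_laplace_density (b : ℝ) :
    Measurable fun x : ℝ => ENNReal.ofReal (1 / (2 * b) * Real.exp (-|x| / b)) := by
  fun_prop

theorem laplace_map_sub_le {b : ℝ} (hb : 0 < b) (δ : ℝ) :
    (laplace b).map (fun x => x - δ) ≤ (Real.exp (|δ| / b)).toNNReal • laplace b := by
  refine Measure.le_iff.2 fun s hs => ?_
  have hm : Measurable fun x : ℝ => x - δ := by fun_prop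
  rw [Measure.map_apply hm hs, laplace, withDensity_apply _ (hm hs), Measure.smul_apply,
    withDensity_apply _ hs, ENNReal.smul_def, smul_eq_mul,
    ← lintegral_const_mul _ (measurable_laplace_density b), ← lintegral_indicator hs,
    ← lintegral_indicator (hm hs)]
  -- Translation invariance aligns both integrals, leaving a pointwise comparison of the densities
  -- at `x` and `x - δ`.
  conv_rhs => rw [← lintegral_sub_right_eq_self _ δ]
  refine lintegral_mono fun x => ?_
  by_cases hx : x - δ ∈ s
  · have hx' : x ∈ (fun x => x - δ) ⁻¹' s := hx
    rw [Set.indicator_of_mem hx, Set.indicator_of_mem hx']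
    change _ ≤ ENNReal.ofReal _ * _
    rw [← ENNReal.ofReal_mul (Real.exp_nonneg _)]
    refine ENNReal.ofReal_le_ofReal ?_
    rw [mul_left_comm, ← Real.exp_add, ← add_div]
    gcongr
    have := abs_sub_abs_le_abs_sub (x - δ) x
    simp only [sub_sub_cancel_left, abs_neg] at this
    linarith
  · have hx' : x ∉ (fun x => x - δ) ⁻¹' s := hx
    simp [Set.indicator_of_notMem hx, Set.indicator_of_notMem hx']

theorem lintegral_sq_laplace {b : ℝ} (hb : 0 < b) :
    ∫⁻ x, ENNReal.ofReal (x ^ 2) ∂(laplace b) = ENNReal.ofReal (2 * b ^ 2) := by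
  have hval : ∫ x : ℝ in Set.Ioi 0, x ^ (2 : ℝ) * Real.exp (-b⁻¹ * x) = 2 * b ^ 3 := by
    have := Real.integral_rpow_mul_exp_neg_mul_Ioi (a := 3) (r := b⁻¹) (by norm_num)
      (by positivity)
    have h2 : (3 : ℝ) - 1 = 2 := by norm_num
    rw [h2] at this
    simp only [neg_mul]
    rw [this]
    have hG : Real.Gamma 3 = 2 := by
      rw [show (3 : ℝ) = ((2 : ℕ) : ℝ) + 1 by norm_num, Real.Gamma_nat_eq_factorial]
      norm_num [Nat.factorial]
    rw [hG, one_div, inv_inv]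
    norm_cast
    ring
  have heq : (fun x : ℝ => 1 / (2 * b) * Real.exp (-|x| / b) * x ^ 2) =
      fun x : ℝ => (fun y : ℝ => 1 / (2 * b) * (y ^ (2 : ℝ) * Real.exp (-b⁻¹ * y))) |x| := by
    funext x
    simp only
    rw [Real.rpow_two, sq_abs, div_eq_mul_inv (-|x|) b]
    ring_nf
  have hint2 : ∫ x : ℝ, 1 / (2 * b) * Real.exp (-|x| / b) * x ^ 2 = 2 * b ^ 2 := by
    rw [heq, integral_comp_abs (f := fun y : ℝ => 1 / (2 * b) * (y ^ (2 : ℝ) *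
      Real.exp (-b⁻¹ * y))), integral_const_mul, hval]
    field_simp
  -- A non-integrable function has Bochner integral 0, so the nonzero value just found yields
  -- integrability.
  have hint : Integrable (fun x : ℝ => 1 / (2 * b) * Real.exp (-|x| / b) * x ^ 2) :=
    Integrable.of_integral_ne_zero (by rw [hint2]; positivity)
  rw [laplace, lintegral_withDensity_eq_lintegral_mul _ (measurable_laplace_density b)
    (by fun_prop)]
  have : ∀ x : ℝ, ((fun x : ℝ => ENNReal.ofReal (1 / (2 * b) * Real.exp (-|x| / b))) *
      fun x : ℝ => ENNReal.ofReal (x ^ 2)) x =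
      ENNReal.ofReal (1 / (2 * b) * Real.exp (-|x| / b) * x ^ 2) := by
    intro x
    rw [Pi.mul_apply, ← ENNReal.ofReal_mul (by positivity)]
  simp_rw [this]
  rw [← ofReal_integral_eq_lintegral_ofReal hint (ae_of_all _ fun x => by positivity), hint2]

end Laplace

/-! ### The zeta series over the reals, indexed from 0. -/

section Zeta

theorem hasSum_zeta {x : ℝ} (hx : 1 < x) :
    HasSum (fun k : ℕ => 1 / ((k : ℝ) + 1) ^ x) (riemannZeta ((x : ℝ) : ℂ)).re := by
  have hs : Summable fun k : ℕ => 1 / ((k : ℝ) + 1) ^ x := by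
    have := (summable_nat_add_iff 1).2 (Real.summable_one_div_nat_rpow.2 hx)
    simpa using this
  have h : riemannZeta ((x : ℝ) : ℂ) = ((∑' k : ℕ, 1 / ((k : ℝ) + 1) ^ x : ℝ) : ℂ) := by
    rw [zeta_eq_tsum_one_div_nat_add_one_cpow (by simpa using hx), Complex.ofReal_tsum]
    refine tsum_congr fun k => ?_
    push_cast
    rw [Complex.ofReal_cpow (by positivity)]
    push_cast
    rfl
  rw [h, Complex.ofReal_re]
  exact hs.hasSum

end Zeta

/-! ### Square summable sequences and measurability of `Phi`. -/

section SquareSummable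

theorem memlp_two_iff_summable_sq (c : ℕ → ℝ) : Memℓp c 2 ↔ Summable fun k => c k ^ 2 := by
  rw [memℓp_gen_iff (by norm_num)]
  simp

theorem memlp_two_iff_tsum_ne_top (c : ℕ → ℝ) :
    Memℓp c 2 ↔ ∑' k, ENNReal.ofReal (c k ^ 2) ≠ ∞ := by
  rw [memlp_two_iff_summable_sq]
  refine ⟨fun h => h.tsum_ofReal_ne_top, fun h => ?_⟩
  have := ENNReal.summable_toReal h
  simpa [ENNReal.toReal_ofReal, sq_nonneg] using this

theorem measurableSet_memlp_two : MeasurableSet {c : ℕ → ℝ | Memℓp c 2} := by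
  simp_rw [memlp_two_iff_tsum_ne_top]
  have : Measurable fun c : ℕ → ℝ => ∑' k, ENNReal.ofReal (c k ^ 2) := by fun_prop
  exact (this (measurableSet_singleton ∞)).compl

variable {d : ℕ} {D : Set (E d)} (e : HilbertBasis ℕ ℝ (L2 D))

theorem hasSum_Phi {c : ℕ → ℝ} (hc : Memℓp c 2) : HasSum (fun k => c k • e k) (Phi e c) := by
  rw [Phi, dif_pos hc]
  exact e.hasSum_repr_symm ⟨c, hc⟩

theorem Phi_repr (g : L2 D) : Phi e (fun k => e.repr g k) = g := by
  have h : Memℓp (fun k => e.repr g k) 2 := lp.memℓp (e.repr g)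
  rw [Phi, dif_pos h]
  exact e.repr.symm_apply_apply g

theorem Phi_sub {c c' : ℕ → ℝ} (hc : Memℓp c 2) (hc' : Memℓp c' 2) :
    Phi e (fun k => c k - c' k) = Phi e c - Phi e c' := by
  have h : Memℓp (fun k => c k - c' k) 2 := hc.sub hc'
  rw [Phi, Phi, Phi, dif_pos hc, dif_pos hc', dif_pos h, ← map_sub]
  rfl

theorem norm_Phi_sq {c : ℕ → ℝ} (hc : Memℓp c 2) : ‖Phi e c‖ ^ 2 = ∑' k, c k ^ 2 := by
  rw [Phi, dif_pos hc, LinearIsometryEquiv.norm_map]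
  have := lp.norm_rpow_eq_tsum (p := 2) (by norm_num) (⟨c, hc⟩ : lp (fun _ : ℕ => ℝ) 2)
  simpa using this

/-- `Phi` is the pointwise limit of partial sums cut off to 0 outside `ℓ₂`; the cut-off agrees with
the default value of `Phi` there. -/
theorem measurable_Phi : Measurable (Phi e) := by
  have hlim : Tendsto (fun (N : ℕ) (c : ℕ → ℝ) =>
      Set.indicator {c : ℕ → ℝ | Memℓp c 2} (fun c => ∑ k ∈ Finset.range N, c k • e k) c)
      atTop (𝓝 (Phi e)) := by
    rw [tendsto_pi_nhds]
    intro c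
    by_cases hc : Memℓp c 2
    · have h := (hasSum_Phi e hc).tendsto_sum_nat
      refine h.congr fun N => ?_
      rw [Set.indicator_of_mem (show c ∈ {c : ℕ → ℝ | Memℓp c 2} from hc)]
    · have h0 : Phi e c = 0 := by rw [Phi, dif_neg hc]
      rw [h0]
      refine tendsto_const_nhds.congr fun N => ?_
      rw [Set.indicator_of_notMem (show c ∉ {c : ℕ → ℝ | Memℓp c 2} from hc)]
  refine measurable_of_tendsto_metrizable (fun N => ?_) hlim
  refine Measurable.indicator ?_ measurableSet_memlp_two
  refine Continuous.measurable ?_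
  fun_prop

end SquareSummable

/-! ### Second moment and square summability of the noise. -/

section Noise

variable {Ω : Type*} [MeasurableSpace Ω] {P : Measure Ω}

theorem lintegral_tsum_sq_noise {γ p : ℝ} (hγ : 0 < γ) (hp : 1 / 2 < p) {ξ : ℕ → Ω → ℝ}
    (hξ : ∀ k, Measurable (ξ k)) (hlaw : ∀ k, P.map (ξ k) = laplace (γ / ((k : ℝ) + 1) ^ p)) :
    ∫⁻ ω, ∑' k, ENNReal.ofReal (ξ k ω ^ 2) ∂P =
      ENNReal.ofReal (2 * γ ^ 2 * (riemannZeta ((2 * p : ℝ) : ℂ)).re) := by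
  rw [lintegral_tsum fun k => by fun_prop]
  have h1 : ∀ k, ∫⁻ ω, ENNReal.ofReal (ξ k ω ^ 2) ∂P =
      ENNReal.ofReal (2 * γ ^ 2 * (1 / ((k : ℝ) + 1) ^ (2 * p))) := by
    intro k
    have := lintegral_map (μ := P) (f := fun x : ℝ => ENNReal.ofReal (x ^ 2)) (by fun_prop) (hξ k)
    rw [← this, hlaw, lintegral_sq_laplace (by positivity)]
    congr 1
    rw [mul_comm 2 p, Real.rpow_mul (by positivity), Real.rpow_two]
    ring
  have hs := (hasSum_zeta (x := 2 * p) (by linarith)).mul_left (2 * γ ^ 2)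
  simp_rw [h1]
  rw [← ENNReal.ofReal_tsum_of_nonneg (fun k => by positivity) hs.summable, hs.tsum_eq]

theorem ae_memlp_noise {γ p : ℝ} (hγ : 0 < γ) (hp : 1 / 2 < p) {ξ : ℕ → Ω → ℝ}
    (hξ : ∀ k, Measurable (ξ k)) (hlaw : ∀ k, P.map (ξ k) = laplace (γ / ((k : ℝ) + 1) ^ p)) :
    ∀ᵐ ω ∂P, Memℓp (fun k => ξ k ω) 2 := by
  have h := lintegral_tsum_sq_noise hγ hp hξ hlaw
  have := ae_lt_top (μ := P) (f := fun ω => ∑' k, ENNReal.ofReal (ξ k ω ^ 2))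
    (by fun_prop) (by rw [h]; exact ENNReal.ofReal_ne_top)
  filter_upwards [this] with ω hω
  exact (memlp_two_iff_tsum_ne_top _).2 hω.ne

variable {d : ℕ} {D : Set (E d)} (e : HilbertBasis ℕ ℝ (L2 D))

theorem measurable_Phi_noise {ξ : ℕ → Ω → ℝ} (hξ : ∀ k, Measurable (ξ k)) :
    Measurable fun ω => Phi e fun k => ξ k ω :=
  (measurable_Phi e).comp (measurable_pi_iff.2 hξ)

theorem lintegral_norm_Phi_sq {γ p : ℝ} (hγ : 0 < γ) (hp : 1 / 2 < p) {ξ : ℕ → Ω → ℝ}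
    (hξ : ∀ k, Measurable (ξ k)) (hlaw : ∀ k, P.map (ξ k) = laplace (γ / ((k : ℝ) + 1) ^ p)) :
    ∫⁻ ω, ENNReal.ofReal (‖Phi e fun k => ξ k ω‖ ^ 2) ∂P =
      ENNReal.ofReal (2 * γ ^ 2 * (riemannZeta ((2 * p : ℝ) : ℂ)).re) := by
  rw [← lintegral_tsum_sq_noise hγ hp hξ hlaw]
  refine lintegral_congr_ae ?_
  filter_upwards [ae_memlp_noise hγ hp hξ hlaw] with ω hω
  rw [norm_Phi_sq e hω, ENNReal.ofReal_tsum_of_nonneg (fun k => sq_nonneg _)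
    ((memlp_two_iff_summable_sq _).1 hω)]

theorem integrable_norm_Phi_sq {γ p : ℝ} (hγ : 0 < γ) (hp : 1 / 2 < p) {ξ : ℕ → Ω → ℝ}
    (hξ : ∀ k, Measurable (ξ k)) (hlaw : ∀ k, P.map (ξ k) = laplace (γ / ((k : ℝ) + 1) ^ p)) :
    Integrable (fun ω => ‖Phi e fun k => ξ k ω‖ ^ 2) P := by
  have hm : Measurable fun ω => ‖Phi e fun k => ξ k ω‖ ^ 2 :=
    ((measurable_Phi_noise e hξ).norm).pow_const 2
  refine ⟨hm.aestronglyMeasurable, ?_⟩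
  rw [hasFiniteIntegral_iff_ofReal (ae_of_all _ fun ω => sq_nonneg _),
    lintegral_norm_Phi_sq e hγ hp hξ hlaw]
  exact ENNReal.ofReal_lt_top

theorem integral_norm_Phi_sq {γ p : ℝ} (hγ : 0 < γ) (hp : 1 / 2 < p) {ξ : ℕ → Ω → ℝ}
    (hξ : ∀ k, Measurable (ξ k)) (hlaw : ∀ k, P.map (ξ k) = laplace (γ / ((k : ℝ) + 1) ^ p)) :
    ∫ ω, ‖Phi e fun k => ξ k ω‖ ^ 2 ∂P = 2 * γ ^ 2 * (riemannZeta ((2 * p : ℝ) : ℂ)).re := by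
  have hm : Measurable fun ω => ‖Phi e fun k => ξ k ω‖ ^ 2 :=
    ((measurable_Phi_noise e hξ).norm).pow_const 2
  rw [integral_eq_lintegral_of_nonneg_ae (ae_of_all _ fun ω => sq_nonneg _)
    hm.aestronglyMeasurable, lintegral_norm_Phi_sq e hγ hp hξ hlaw, ENNReal.toReal_ofReal]
  have := (hasSum_zeta (x := 2 * p) (by linarith)).nonneg fun k => by positivity
  positivity

end Noise

/-! ### Differential privacy of the perturbed functions. -/

section Privacy

variable {Ω : Type*} [MeasurableSpace Ω] {P : Measure Ω}
variable {d n : ℕ} {D : Set (E d)} (e : HilbertBasis ℕ ℝ (L2 D))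

/-- Writing `k^p = k^q · k^{-(q-p)}` and applying Cauchy–Schwarz separates the adjacency norm from
the zeta series. Finite sums are enough for the cylinder comparison. -/
theorem sum_div_scale_le {γ p q : ℝ} (hγ : 0 < γ) (hpq : p < q - 1 / 2) {g : L2 D}
    (hg : g ∈ adjSpace e q) (J : Finset ℕ) :
    ∑ k ∈ J, |e.repr g k| / (γ / ((k : ℝ) + 1) ^ p) ≤
      Real.sqrt (riemannZeta ((2 * (q - p) : ℝ) : ℂ)).re / γ * adjNorm e q g := by
  have hz := hasSum_zeta (x := 2 * (q - p)) (by linarith)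
  have h1 : ∑ k ∈ J, |e.repr g k| / (γ / ((k : ℝ) + 1) ^ p) =
      1 / γ * ∑ k ∈ J, (((k : ℝ) + 1) ^ q * |e.repr g k|) * (1 / ((k : ℝ) + 1) ^ (q - p)) := by
    rw [Finset.mul_sum]
    refine Finset.sum_congr rfl fun k _ => ?_
    have hk : (0 : ℝ) < (k : ℝ) + 1 := by positivity
    rw [Real.rpow_sub hk]
    field_simp
  have h2 : ∑ k ∈ J, (((k : ℝ) + 1) ^ q * |e.repr g k|) ^ 2 ≤
      ∑' k : ℕ, (((k : ℝ) + 1) ^ q * e.repr g k) ^ 2 := by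
    refine le_trans (le_of_eq ?_) (Summable.sum_le_tsum J (fun k _ => sq_nonneg _) hg)
    refine Finset.sum_congr rfl fun k _ => ?_
    rw [mul_pow, sq_abs, mul_pow]
  have h3 : ∑ k ∈ J, (1 / ((k : ℝ) + 1) ^ (q - p)) ^ 2 ≤
      (riemannZeta ((2 * (q - p) : ℝ) : ℂ)).re := by
    refine le_trans (le_of_eq ?_) (sum_le_hasSum J (fun k _ => by positivity) hz)
    refine Finset.sum_congr rfl fun k _ => ?_
    rw [mul_comm 2 (q - p), Real.rpow_mul (by positivity), Real.rpow_two]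
    ring
  rw [h1]
  calc 1 / γ * ∑ k ∈ J, (((k : ℝ) + 1) ^ q * |e.repr g k|) * (1 / ((k : ℝ) + 1) ^ (q - p))
      ≤ 1 / γ * (√(∑ k ∈ J, (((k : ℝ) + 1) ^ q * |e.repr g k|) ^ 2) *
          √(∑ k ∈ J, (1 / ((k : ℝ) + 1) ^ (q - p)) ^ 2)) := by
        gcongr
        exact Real.sum_mul_le_sqrt_mul_sqrt _ _ _
    _ ≤ 1 / γ * (adjNorm e q g * √(riemannZeta ((2 * (q - p) : ℝ) : ℂ)).re) := by
        have h4 : √(∑ k ∈ J, (((k : ℝ) + 1) ^ q * |e.repr g k|) ^ 2) ≤ adjNorm e q g :=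
          Real.sqrt_le_sqrt h2
        exact mul_le_mul_of_nonneg_left (mul_le_mul h4 (Real.sqrt_le_sqrt h3)
          (Real.sqrt_nonneg _) (Real.sqrt_nonneg _)) (by positivity)
    _ = _ := by ring

theorem measure_shift_le {ι : Type*} [Countable ι] [IsProbabilityMeasure P] {ξ : ι → Ω → ℝ}
    (hξ : ∀ i, Measurable (ξ i)) (hindep : iIndepFun ξ P) {b : ι → ℝ} (hb : ∀ i, 0 < b i)
    (hlaw : ∀ i, P.map (ξ i) = laplace (b i)) (δ : ι → ℝ) (K : ℝ)
    (hK : ∀ I : Finset ι, ∑ i ∈ I, |δ i| / b i ≤ K) {B : Set (ι → ℝ)} (hB : MeasurableSet B) :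
    P {ω | (fun i => ξ i ω - δ i) ∈ B} ≤
      ENNReal.ofReal (Real.exp K) * P {ω | (fun i => ξ i ω) ∈ B} := by
  have hsub : ∀ i, Measurable fun x : ℝ => x - δ i := fun i => by fun_prop
  have hξδ : ∀ i, Measurable fun ω => ξ i ω - δ i := fun i => by fun_prop
  have hindep' : iIndepFun (fun i ω => ξ i ω - δ i) P :=
    hindep.comp (fun i x => x - δ i) hsub
  have e1 := hindep.map_fun_eq_infinitePi_map hξ
  have e2 := hindep'.map_fun_eq_infinitePi_map hξδ
  have hpr : ∀ i, IsProbabilityMeasure (P.map (ξ i)) := fun i =>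
    Measure.isProbabilityMeasure_map (hξ i).aemeasurable
  have hpr' : ∀ i, IsProbabilityMeasure (P.map fun ω => ξ i ω - δ i) := fun i =>
    Measure.isProbabilityMeasure_map (hξδ i).aemeasurable
  have key := infinitePi_le_smul (fun i => P.map (ξ i)) (fun i => P.map fun ω => ξ i ω - δ i)
    (fun i => (Real.exp (|δ i| / b i)).toNNReal) (Real.exp K).toNNReal
    (fun i => by
      have h := laplace_map_sub_le (hb i) (δ i)
      rw [← hlaw i, Measure.map_map (hsub i) (hξ i)] at h
      exact h)
    (fun I => by
      rw [← Real.toNNReal_prod_of_nonneg fun i _ => Real.exp_nonneg _, ← Real.exp_sum]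
      exact Real.toNNReal_le_toNNReal (Real.exp_le_exp.2 (hK I)))
  rw [← e1, ← e2] at key
  have := key B
  rw [Measure.smul_apply, Measure.map_apply (measurable_pi_iff.2 hξδ) hB,
    Measure.map_apply (measurable_pi_iff.2 hξ) hB] at this
  exact this

theorem measurable_perturbed {u α β : ℝ} (hproj : Measurable (proj (closure (SClass D u α β))))
    {s : Fin n → L2 D → L2 D} (hs : ∀ i, Measurable (s i)) (F : Fin n → L2 D) :
    Measurable (perturbed u α β e s F) := by
  refine measurable_pi_iff.2 fun i => ?_
  refine hproj.comp ((hs i).comp ?_)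
  have h1 : Measurable fun g : L2 D => F i + g :=
    (continuous_const.add continuous_id).measurable
  exact h1.comp ((measurable_Phi e).comp (measurable_pi_apply i))

theorem perturbed_shift {u α β : ℝ} {s : Fin n → L2 D → L2 D} {F F' : Fin n → L2 D} {i₀ : Fin n}
    (hF : ∀ i, i ≠ i₀ → F i = F' i) {c : Fin n → ℕ → ℝ} (hc : ∀ i, Memℓp (c i) 2)
    {δ : Fin n → ℕ → ℝ} (hδ₀ : ∀ k, δ i₀ k = e.repr (F i₀ - F' i₀) k)
    (hδ : ∀ i, i ≠ i₀ → ∀ k, δ i k = 0) :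
    perturbed u α β e s F' c = perturbed u α β e s F fun i k => c i k - δ i k := by
  funext i
  unfold perturbed
  congr 2
  by_cases hi : i = i₀
  · subst hi
    simp only [hδ₀]
    -- Square summability is essential: outside `ℓ₂` the default value 0 of `Phi` destroys
    -- additivity.
    rw [Phi_sub e (hc i) (lp.memℓp _), Phi_repr]
    abel
  · simp only [hδ i hi, sub_zero]
    rw [hF i hi]

/-- The map `T` is arbitrary post-processing: the identity for the functions themselves,
`transcript` for the messages. -/
theorem isDiffPrivate_perturbed [IsProbabilityMeasure P] {u α β : ℝ}
    (hproj : Measurable (proj (closure (SClass D u α β))))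
    {q γ p : Fin n → ℝ} (hγ : ∀ i, 0 < γ i) (hp : ∀ i, 1 / 2 < p i ∧ p i < q i - 1 / 2)
    {η : Fin n → ℕ → Ω → ℝ} (hη : ∀ i k, Measurable (η i k))
    (hindep : iIndepFun (fun (ik : Fin n × ℕ) => η ik.1 ik.2) P)
    (hlaw : ∀ i k, P.map (η i k) = laplace (γ i / ((k : ℝ) + 1) ^ p i))
    {s : Fin n → L2 D → L2 D} (hs : ∀ i, Measurable (s i))
    {Y : Type*} [MeasurableSpace Y] {T : (Fin n → L2 D) → Y} (hT : Measurable T) :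
    IsDiffPrivate e q P (fun F ω => T (perturbed u α β e s F fun i k => η i k ω))
      (fun i => Real.sqrt (riemannZeta ((2 * (q i - p i) : ℝ) : ℂ)).re / γ i) := by
  intro F F' i₀ hF hadj O hO
  set g : L2 D := F i₀ - F' i₀ with hg
  let δ : Fin n × ℕ → ℝ := fun ik => if ik.1 = i₀ then e.repr g ik.2 else 0
  let R : (Fin n × ℕ → ℝ) → Y := fun c => T (perturbed u α β e s F fun i k => c (i, k))
  have hR : Measurable R := by
    refine hT.comp ((measurable_perturbed e hproj hs F).comp ?_)
    exact measurable_pi_iff.2 fun i => measurable_pi_iff.2 fun k => measurable_pi_apply (i, k)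
  have hmem : ∀ᵐ ω ∂P, ∀ i, Memℓp (fun k => η i k ω) 2 :=
    ae_all_iff.2 fun i => ae_memlp_noise (hγ i) (hp i).1 (hη i) (hlaw i)
  have hshift : P {ω | T (perturbed u α β e s F' fun i k => η i k ω) ∈ O} =
      P {ω | (fun ik : Fin n × ℕ => η ik.1 ik.2 ω - δ ik) ∈ R ⁻¹' O} := by
    -- The two events agree only almost surely, namely where the noise is square summable.
    refine measure_congr ?_
    filter_upwards [hmem] with ω hω
    have h : T (perturbed u α β e s F' fun i k => η i k ω) =
        R fun ik => η ik.1 ik.2 ω - δ ik :=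
      congrArg T (perturbed_shift e hF hω (δ := fun i k => δ (i, k)) (fun k => by simp [δ, hg])
        fun i hi k => by simp [δ, hi])
    exact congrArg (· ∈ O) h
  change P {ω | T (perturbed u α β e s F' fun i k => η i k ω) ∈ O} ≤ _
  rw [hshift]
  refine measure_shift_le (ξ := fun ik : Fin n × ℕ => η ik.1 ik.2) (fun ik => hη ik.1 ik.2)
    hindep (b := fun ik => γ ik.1 / ((ik.2 : ℝ) + 1) ^ p ik.1)
    (fun ik => div_pos (hγ _) (by positivity)) (fun ik => hlaw ik.1 ik.2) δ _ ?_ (hR hO)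
  intro I
  have hpos : ∀ ik : Fin n × ℕ, 0 ≤ |δ ik| / (γ ik.1 / ((ik.2 : ℝ) + 1) ^ p ik.1) := fun ik =>
    div_nonneg (abs_nonneg _) (div_nonneg (hγ _).le (by positivity))
  -- Enlarging the index set to a rectangle makes it a sum over rows, of which only row `i₀`
  -- contributes.
  calc ∑ ik ∈ I, |δ ik| / (γ ik.1 / ((ik.2 : ℝ) + 1) ^ p ik.1)
      ≤ ∑ ik ∈ Finset.univ ×ˢ I.image Prod.snd,
          |δ ik| / (γ ik.1 / ((ik.2 : ℝ) + 1) ^ p ik.1) := by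
        refine Finset.sum_le_sum_of_subset_of_nonneg (fun ik hik => ?_) fun ik _ _ => hpos ik
        exact Finset.mem_product.2 ⟨Finset.mem_univ _, Finset.mem_image_of_mem _ hik⟩
    _ = ∑ k ∈ I.image Prod.snd, |e.repr g k| / (γ i₀ / ((k : ℝ) + 1) ^ p i₀) := by
        rw [Finset.sum_product_right]
        refine Finset.sum_congr rfl fun k _ => ?_
        rw [Finset.sum_eq_single i₀]
        · simp [δ]
        · intro i _ hi
          simp [δ, hi]
        · simp
    _ ≤ _ := sum_div_scale_le e (hγ i₀) (hp i₀).2 hadj _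

end Privacy

/-! ### Measurability of the algorithm in its objective functions. -/

section Transcript

variable {d n : ℕ} {D : Set (E d)} {G : Digraph (Fin n)} {State Msg : Type*}
  [MeasurableSpace State] [MeasurableSpace Msg]

theorem DistAlg.measurable_run (A : DistAlg D G State Msg) (z : Fin n → State) (k : ℕ) :
    ∀ i, Measurable fun g : Fin n → L2 D => A.run z g k i := by
  induction k with
  | zero => exact fun i => measurable_const
  | succ k ih =>
    intro i
    have h : Measurable fun g : Fin n → L2 D => (g i, A.run z g k i,
        fun j : {j : Fin n // G.Adj j i} => A.send k j.1 (g j.1) (A.run z g k j.1)) :=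
      (measurable_pi_apply i).prodMk ((ih i).prodMk (measurable_pi_iff.2 fun j =>
        (A.measurable_send k j.1).comp ((measurable_pi_apply j.1).prodMk (ih j.1))))
    exact (A.measurable_update k i).comp h

theorem DistAlg.measurable_transcript (A : DistAlg D G State Msg) (z : Fin n → State) :
    Measurable (A.transcript z) :=
  measurable_pi_iff.2 fun k => measurable_pi_iff.2 fun i =>
    (A.measurable_send k i).comp ((measurable_pi_apply i).prodMk (A.measurable_run z k i))

end Transcript

/-! ### Projection onto a closed convex set. -/

section Projection

variable {H : Type*} [NormedAddCommGroup H] [InnerProductSpace ℝ H] [CompleteSpace H]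
  {K : Set H}

theorem proj_spec (hne : K.Nonempty) (hcl : IsClosed K) (hcv : Convex ℝ K) (h : H) :
    proj K h ∈ K ∧ ∀ w ∈ K, ‖h - proj K h‖ ≤ ‖h - w‖ := by
  obtain ⟨v, hv, hmin⟩ := exists_norm_eq_iInf_of_complete_convex hne hcl.isComplete hcv h
  refine Classical.epsilon_spec (p := fun v => v ∈ K ∧ ∀ w ∈ K, ‖h - v‖ ≤ ‖h - w‖)
    ⟨v, hv, fun w hw => ?_⟩
  rw [hmin]
  exact ciInf_le ⟨0, Set.forall_mem_range.2 fun _ => norm_nonneg _⟩ (⟨w, hw⟩ : K)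

theorem inner_sub_proj_nonpos (hne : K.Nonempty) (hcl : IsClosed K) (hcv : Convex ℝ K) (h : H)
    {w : H} (hw : w ∈ K) : inner ℝ (h - proj K h) (w - proj K h) ≤ 0 := by
  obtain ⟨hp, hmin⟩ := proj_spec hne hcl hcv h
  have : Nonempty K := hne.to_subtype
  refine (norm_eq_iInf_iff_real_inner_le_zero hcv hp).1 (le_antisymm ?_ ?_) w hw
  · exact le_ciInf fun w => hmin w.1 w.2
  · exact ciInf_le ⟨0, Set.forall_mem_range.2 fun _ => norm_nonneg _⟩ (⟨_, hp⟩ : K)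

/-- The sum of the variational inequalities at the two projections gives `‖a - b‖² ≤ ⟪h - h', a -
b⟫`, and Cauchy–Schwarz concludes. -/
theorem norm_proj_sub_proj_le (hne : K.Nonempty) (hcl : IsClosed K) (hcv : Convex ℝ K)
    (h h' : H) : ‖proj K h - proj K h'‖ ≤ ‖h - h'‖ := by
  have h1 := inner_sub_proj_nonpos hne hcl hcv h (proj_spec hne hcl hcv h').1
  have h2 := inner_sub_proj_nonpos hne hcl hcv h' (proj_spec hne hcl hcv h).1
  set a := proj K h
  set b := proj K h'
  have h3 : ‖a - b‖ ^ 2 ≤ inner ℝ (h - h') (a - b) := by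
    rw [← real_inner_self_eq_norm_sq]
    have e1 : inner ℝ (h - a) (b - a) = - inner ℝ (h - a) (a - b) := by
      rw [← inner_neg_right, neg_sub]
    have e2 : inner ℝ (h - h') (a - b) =
        inner ℝ (h - a) (a - b) + inner ℝ (a - b) (a - b) - inner ℝ (h' - b) (a - b) := by
      rw [← inner_add_left, ← inner_sub_left]
      congr 1
      abel
    linarith
  have h4 := real_inner_le_norm (h - h') (a - b)
  rcases (norm_nonneg (a - b)).eq_or_lt with h0 | h0
  · rw [← h0]
    exact norm_nonneg _
  · nlinarith

theorem continuous_proj (hne : K.Nonempty) (hcl : IsClosed K) (hcv : Convex ℝ K) :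
    Continuous (proj K) := by
  refine (LipschitzWith.of_dist_le_mul (K := 1) fun h h' => ?_).continuous
  rw [dist_eq_norm, dist_eq_norm, NNReal.coe_one, one_mul]
  exact norm_proj_sub_proj_le hne hcl hcv h h'

theorem proj_of_mem (hne : K.Nonempty) (hcl : IsClosed K) (hcv : Convex ℝ K) {w : H}
    (hw : w ∈ K) : proj K w = w := by
  have := (proj_spec hne hcl hcv w).2 w hw
  rw [sub_self, norm_zero] at this
  exact (sub_eq_zero.1 (norm_le_zero_iff.1 this)).symm

end Projection

/-! ### Strong convexity and convexity of the class `𝒮`. -/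

section Regular

variable {d : ℕ} {D : Set (E d)} {u α β : ℝ}

theorem mem_closure_interior (hD : Convex ℝ D) (hint : (interior D).Nonempty) {x : E d}
    (hx : x ∈ D) : x ∈ closure (interior D) := by
  rw [hD.closure_interior_eq_closure_of_nonempty_interior hint]
  exact subset_closure hx

theorem IsRegular.contDiffAt {h : E d → ℝ} (hh : IsRegular D u α β h) {x : E d}
    (hx : x ∈ interior D) : ContDiffAt ℝ 2 h x :=
  hh.1.contDiffAt (mem_interior_iff_mem_nhds.1 hx)

theorem IsRegular.lipschitz (hD : Convex ℝ D) {h : E d → ℝ} (hh : IsRegular D u α β h)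
    {x y : E d} (hx : x ∈ D) (hy : y ∈ D) : |h x - h y| ≤ u * ‖x - y‖ := by
  have := hD.norm_image_sub_le_of_norm_fderivWithin_le (𝕜 := ℝ)
    (hh.1.differentiableOn (by norm_num)) hh.2.1 hy hx
  simpa using this

/-- Along a segment, subtracting `α‖v‖²t²/2` leaves a function of `t` with nonnegative second
derivative. -/
theorem strongConvexOn_of_fderiv_fderiv {U : Set (E d)} (hU : IsOpen U) (hUc : Convex ℝ U)
    {h : E d → ℝ} (hh : ContDiffOn ℝ 2 h U)
    (hess : ∀ x ∈ U, ∀ v : E d, α * ‖v‖ ^ 2 ≤ fderiv ℝ (fderiv ℝ h) x v v) :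
    StrongConvexOn U α h := by
  refine ⟨hUc, fun x hx y hy a b ha hb hab => ?_⟩
  set v := y - x with hv
  have hseg : ∀ t ∈ Set.Icc (0 : ℝ) 1, x + t • v ∈ U := fun t ht => by
    have := hUc hx hy (sub_nonneg.2 ht.2) ht.1 (by ring)
    convert this using 1
    rw [hv]
    module
  have hline : ∀ t : ℝ, HasDerivAt (fun t : ℝ => x + t • v) v t := fun t => by
    simpa using ((hasDerivAt_id t).smul_const v).const_add x
  have hat : ∀ t ∈ Set.Icc (0 : ℝ) 1, ContDiffAt ℝ 2 h (x + t • v) := fun t ht =>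
    hh.contDiffAt (hU.mem_nhds (hseg t ht))
  have h1 : ∀ t ∈ Set.Icc (0 : ℝ) 1,
      HasDerivAt (fun t : ℝ => h (x + t • v)) (fderiv ℝ h (x + t • v) v) t := fun t ht =>
    (((hat t ht).differentiableAt (by norm_num)).hasFDerivAt).comp_hasDerivAt t (hline t)
  have h2 : ∀ t ∈ Set.Icc (0 : ℝ) 1, HasDerivAt (fun t : ℝ => fderiv ℝ h (x + t • v) v)
      (fderiv ℝ (fderiv ℝ h) (x + t • v) v v) t := fun t ht => by
    have hd : DifferentiableAt ℝ (fderiv ℝ h) (x + t • v) :=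
      ((hat t ht).fderiv_right (m := 1) (by norm_num)).differentiableAt (by norm_num)
    have := hd.hasFDerivAt.comp_hasDerivAt t (hline t)
    have := (ContinuousLinearMap.apply ℝ ℝ v).hasFDerivAt.comp_hasDerivAt t this
    exact this
  have hcv : ConvexOn ℝ (Set.Icc (0 : ℝ) 1)
      (fun t : ℝ => h (x + t • v) - α * ‖v‖ ^ 2 / 2 * t ^ 2) := by
    refine convexOn_of_hasDerivWithinAt2_nonneg (convex_Icc 0 1)
      (f' := fun t => fderiv ℝ h (x + t • v) v - α * ‖v‖ ^ 2 * t)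
      (f'' := fun t => fderiv ℝ (fderiv ℝ h) (x + t • v) v v - α * ‖v‖ ^ 2) ?_ ?_ ?_ ?_
    · intro t ht
      refine ContinuousWithinAt.sub (h1 t ht).continuousAt.continuousWithinAt ?_
      fun_prop
    · intro t ht
      refine HasDerivAt.hasDerivWithinAt ?_
      refine (h1 t (interior_subset ht)).sub ?_
      have := ((hasDerivAt_id t).pow 2).const_mul (α * ‖v‖ ^ 2 / 2)
      refine this.congr_deriv ?_
      simp only [id]
      push_cast
      ring
    · intro t ht
      refine HasDerivAt.hasDerivWithinAt ?_
      refine (h2 t (interior_subset ht)).sub ?_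
      simpa using (hasDerivAt_id t).const_mul (α * ‖v‖ ^ 2)
    · intro t ht
      exact sub_nonneg.2 (hess _ (hseg t (interior_subset ht)) v)
  have := hcv.2 (Set.left_mem_Icc.2 zero_le_one) (Set.right_mem_Icc.2 zero_le_one) ha hb hab
  simp only [smul_eq_mul, mul_zero, mul_one, zero_add, zero_smul, add_zero, one_smul] at this
  have e1 : x + b • v = a • x + b • y := by
    have hb' : a = 1 - b := by linarith
    rw [hv, hb']
    module
  have e2 : x + v = y := by rw [hv]; abel
  rw [e1, e2, norm_sub_rev y x] at this
  have e3 : a = 1 - b := by linarith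
  rw [smul_eq_mul, smul_eq_mul]
  refine (sub_le_iff_le_add.1 this).trans (le_of_eq ?_)
  rw [e3]
  ring

/-- The contraction `T z t` towards an interior point sends `D` into its interior for `t > 0` and
commutes with convex combinations, so the inequality passes to the limit `t → 0⁺`. -/
theorem strongConvexOn_of_interior (hD : Convex ℝ D) (hint : (interior D).Nonempty)
    {h : E d → ℝ} (hc : ContinuousOn h D) (hh : StrongConvexOn (interior D) α h) :
    StrongConvexOn D α h := by
  refine ⟨hD, fun x hx y hy a b ha hb hab => ?_⟩
  obtain ⟨c, hcD⟩ := hint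
  let T : E d → ℝ → E d := fun z t => z + t • (c - z)
  have hTint : ∀ z ∈ D, ∀ t ∈ Set.Ioc (0 : ℝ) 1, T z t ∈ interior D := fun z hz t ht =>
    hD.add_smul_sub_mem_interior hz hcD ht
  have hT : ∀ z, Tendsto (T z) (𝓝[>] 0) (𝓝 z) := fun z => by
    have : Continuous (T z) := by fun_prop
    have h0 : T z 0 = z := by simp [T]
    have := (this.tendsto 0).mono_left (nhdsWithin_le_nhds (s := Set.Ioi 0))
    rwa [h0] at this
  have hev : ∀ᶠ t in 𝓝[>] (0 : ℝ), t ∈ Set.Ioc (0 : ℝ) 1 := Ioc_mem_nhdsGT one_pos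
  have hhT : ∀ z ∈ D, Tendsto (fun t => h (T z t)) (𝓝[>] 0) (𝓝 (h z)) := fun z hz =>
    (hc z hz).tendsto.comp (tendsto_nhdsWithin_iff.2
      ⟨hT z, hev.mono fun t ht => interior_subset (hTint z hz t ht)⟩)
  have hw : a • x + b • y ∈ D := hD hx hy ha hb hab
  have hcomb : ∀ t, T (a • x + b • y) t = a • T x t + b • T y t := fun t => by
    have hb' : b = 1 - a := by linarith
    simp only [T, hb']
    module
  have hR : Tendsto (fun t => a • h (T x t) + b • h (T y t)
      - a * b * (α / 2 * ‖T x t - T y t‖ ^ 2)) (𝓝[>] 0)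
      (𝓝 (a • h x + b • h y - a * b * (α / 2 * ‖x - y‖ ^ 2))) :=
    (((hhT x hx).const_smul a).add ((hhT y hy).const_smul b)).sub
      ((((((hT x).sub (hT y)).norm).pow 2).const_mul _).const_mul _)
  refine le_of_tendsto_of_tendsto (hhT _ hw) hR ?_
  filter_upwards [hev] with t ht
  rw [hcomb]
  exact hh.2 (hTint x hx t ht) (hTint y hy t ht) ha hb hab

theorem IsRegular.strongConvexOn (hD : Convex ℝ D) (hint : (interior D).Nonempty)
    {h : E d → ℝ} (hh : IsRegular D u α β h) : StrongConvexOn D α h :=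
  strongConvexOn_of_interior hD hint hh.1.continuousOn
    (strongConvexOn_of_fderiv_fderiv isOpen_interior hD.interior
      (hh.1.mono interior_subset) fun x hx v => (hh.2.2 x hx v).1)

theorem IsRegular.combo (hD : Convex ℝ D) (hint : (interior D).Nonempty) {h₁ h₂ : E d → ℝ}
    (hh₁ : IsRegular D u α β h₁) (hh₂ : IsRegular D u α β h₂) {a b : ℝ} (ha : 0 ≤ a) (hb : 0 ≤ b)
    (hab : a + b = 1) : IsRegular D u α β (a • h₁ + b • h₂) := by
  have hud := uniqueDiffOn_convex hD hint
  have hd₁ := hh₁.1.differentiableOn (by norm_num)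
  have hd₂ := hh₂.1.differentiableOn (by norm_num)
  refine ⟨(hh₁.1.const_smul a).add (hh₂.1.const_smul b), fun x hx => ?_, fun x hx v => ?_⟩
  · rw [fderivWithin_add (hud x hx) ((hd₁ x hx).const_smul a) ((hd₂ x hx).const_smul b),
      fderivWithin_const_smul (hud x hx) (hd₁ x hx),
      fderivWithin_const_smul (hud x hx) (hd₂ x hx)]
    calc _ ≤ a * u + b * u := by
          refine (norm_add_le _ _).trans ?_
          rw [norm_smul, norm_smul, Real.norm_of_nonneg ha, Real.norm_of_nonneg hb]
          gcongr
          · exact hh₁.2.1 x hx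
          · exact hh₂.2.1 x hx
      _ = u := by rw [← add_mul, hab, one_mul]
  · have hc : ∀ {h : E d → ℝ}, IsRegular D u α β h → DifferentiableAt ℝ (fderiv ℝ h) x :=
      fun hh => ((hh.contDiffAt hx).fderiv_right (m := 1) (by norm_num)).differentiableAt
        (by norm_num)
    have heq : fderiv ℝ (a • h₁ + b • h₂) =ᶠ[𝓝 x] a • fderiv ℝ h₁ + b • fderiv ℝ h₂ := by
      filter_upwards [isOpen_interior.mem_nhds hx] with y hy
      have e₁ := (hh₁.contDiffAt hy).differentiableAt (by norm_num)
      have e₂ := (hh₂.contDiffAt hy).differentiableAt (by norm_num)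
      rw [fderiv_add (e₁.const_smul a) (e₂.const_smul b), fderiv_const_smul e₁,
        fderiv_const_smul e₂]
      rfl
    rw [heq.fderiv_eq, fderiv_add ((hc hh₁).const_smul a) ((hc hh₂).const_smul b),
      fderiv_const_smul (hc hh₁), fderiv_const_smul (hc hh₂)]
    obtain ⟨l₁, r₁⟩ := hh₁.2.2 x hx v
    obtain ⟨l₂, r₂⟩ := hh₂.2.2 x hx v
    simp only [add_apply, smul_apply, smul_eq_mul]
    have hb' : b = 1 - a := by linarith
    constructor
    · calc α * ‖v‖ ^ 2 = a * (α * ‖v‖ ^ 2) + b * (α * ‖v‖ ^ 2) := by rw [hb']; ring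
        _ ≤ _ := by gcongr
    · calc _ ≤ a * (β * ‖v‖ ^ 2) + b * (β * ‖v‖ ^ 2) := by gcongr
        _ = _ := by rw [hb']; ring

theorem convex_SClass (hD : Convex ℝ D) (hint : (interior D).Nonempty) :
    Convex ℝ (SClass D u α β) := by
  rintro g₁ ⟨h₁, hh₁, e₁⟩ g₂ ⟨h₂, hh₂, e₂⟩ a b ha hb hab
  refine ⟨a • h₁ + b • h₂, hh₁.combo hD hint hh₂ ha hb hab, ?_⟩
  filter_upwards [e₁, e₂, Lp.coeFn_add (a • g₁) (b • g₂), Lp.coeFn_smul a g₁,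
    Lp.coeFn_smul b g₂] with x x₁ x₂ x₃ x₄ x₅
  rw [x₃, Pi.add_apply, x₄, x₅]
  simp [x₁, x₂]

end Regular

/-! ### Properties of `𝒮` that survive `L₂` limits. -/

section ClosedClass

variable {d : ℕ} {D : Set (E d)} {u α : ℝ}

/-- `h` is `u`-Lipschitz and `α`-strongly convex on `D`. -/
def IsLipStrong (D : Set (E d)) (u α : ℝ) (h : E d → ℝ) : Prop :=
  (∀ x ∈ D, ∀ y ∈ D, |h x - h y| ≤ u * ‖x - y‖) ∧ StrongConvexOn D α h

theorem IsLipStrong.continuousOn (hu : 0 ≤ u) {h : E d → ℝ} (hh : IsLipStrong D u α h) :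
    ContinuousOn h D := by
  refine LipschitzOnWith.continuousOn (K := u.toNNReal) (LipschitzOnWith.of_dist_le_mul
    fun x hx y hy => ?_)
  rw [Real.dist_eq, dist_eq_norm, Real.coe_toNNReal u hu]
  exact hh.1 x hx y hy

theorem exists_mem_near_of_ae (hD : Convex ℝ D) (hint : (interior D).Nonempty) {p : E d → Prop}
    (hp : ∀ᵐ x ∂(volume : Measure (E d)).restrict D, p x) {x : E d} (hx : x ∈ D) {δ : ℝ}
    (hδ : 0 < δ) : ∃ y ∈ D, p y ∧ ‖x - y‖ < δ := by
  have hU : IsOpen (Metric.ball x δ ∩ interior D) := Metric.isOpen_ball.inter isOpen_interior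
  have hne : (Metric.ball x δ ∩ interior D).Nonempty :=
    mem_closure_iff.1 (mem_closure_interior hD hint hx) _ Metric.isOpen_ball
      (Metric.mem_ball_self hδ)
  have hpos := hU.measure_pos volume hne
  by_contra hcon
  push Not at hcon
  have hsub : Metric.ball x δ ∩ interior D ⊆ {y | ¬ p y} := fun y hy hpy => by
    have h1 := hcon y (interior_subset hy.2) hpy
    have h2 := Metric.mem_ball.1 hy.1
    rw [dist_comm, dist_eq_norm] at h2
    linarith
  have h0 : (volume : Measure (E d)).restrict D {y | ¬ p y} = 0 := hp
  have h1 := measure_mono_null hsub h0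
  rw [Measure.restrict_apply hU.measurableSet,
    Set.inter_eq_self_of_subset_left (Set.inter_subset_right.trans interior_subset)] at h1
  exact hpos.ne' h1

theorem exists_tendsto_of_ae_tendsto (hD : Convex ℝ D) (hint : (interior D).Nonempty)
    (hu : 0 < u) {h : ℕ → E d → ℝ} (hh : ∀ k, ∀ x ∈ D, ∀ y ∈ D, |h k x - h k y| ≤ u * ‖x - y‖)
    {g : E d → ℝ} (hg : ∀ᵐ x ∂(volume : Measure (E d)).restrict D,
      Tendsto (fun k => h k x) atTop (𝓝 (g x))) {x : E d} (hx : x ∈ D) :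
    ∃ l, Tendsto (fun k => h k x) atTop (𝓝 l) := by
  refine cauchySeq_tendsto_of_complete (Metric.cauchySeq_iff'.2 fun ε hε => ?_)
  -- Radius `ε / (4u)`: moving from `x` to `y` costs `ε/4` for each of two indices, and the Cauchy
  -- property at `y` another `ε/4`.
  obtain ⟨y, hy, hconv, hxy⟩ := exists_mem_near_of_ae hD hint hg hx
    (δ := ε / (4 * u)) (by positivity)
  obtain ⟨N, hN⟩ := Metric.cauchySeq_iff'.1 hconv.cauchySeq (ε / 4) (by positivity)
  refine ⟨N, fun k hk => ?_⟩
  have h1 := hh k x hx y hy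
  have h2 := hh N x hx y hy
  have h3 := hN k hk
  have h4 : u * ‖x - y‖ ≤ ε / 4 := by
    calc u * ‖x - y‖ ≤ u * (ε / (4 * u)) := by gcongr
      _ = ε / 4 := by field_simp
  rw [Real.dist_eq] at h3 ⊢
  rw [abs_le] at h1 h2
  rw [abs_lt] at h3 ⊢
  constructor <;> linarith [h1.1, h1.2, h2.1, h2.2, h3.1, h3.2]

/-- A subsequence converges almost everywhere, and the common Lipschitz bound upgrades this to
convergence at every point of `D`. Both defining properties are pointwise inequalities and pass to
that limit, whereas bounds on second derivatives would not. -/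
theorem isClosed_lipStrong (hD : Convex ℝ D) (hint : (interior D).Nonempty) (hu : 0 < u) :
    IsClosed {g : L2 D | ∃ h : E d → ℝ, IsLipStrong D u α h ∧
      g =ᵐ[(volume : Measure (E d)).restrict D] h} := by
  refine IsSeqClosed.isClosed fun G g hG hlim => ?_
  choose H hH hGH using hG
  obtain ⟨φ, -, hφ⟩ := (tendstoInMeasure_of_tendsto_Lp hlim).exists_seq_tendsto_ae
  have hae : ∀ᵐ x ∂(volume : Measure (E d)).restrict D,
      Tendsto (fun k => H (φ k) x) atTop (𝓝 (g x)) := by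
    filter_upwards [hφ, ae_all_iff.2 fun k => hGH (φ k)] with x hx hx'
    exact hx.congr hx'
  choose! l hl using fun x (hx : x ∈ D) =>
    exists_tendsto_of_ae_tendsto hD hint hu (fun k => (hH (φ k)).1) hae hx
  refine ⟨l, ⟨fun x hx y hy => ?_, hD, fun x hx y hy a b ha hb hab => ?_⟩, ?_⟩
  · exact le_of_tendsto (((hl x hx).sub (hl y hy)).abs)
      (Eventually.of_forall fun k => (hH (φ k)).1 x hx y hy)
  · exact le_of_tendsto_of_tendsto (hl _ (hD hx hy ha hb hab))
      ((((hl x hx).const_smul a).add ((hl y hy).const_smul b)).sub_const _)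
      (Eventually.of_forall fun k => (hH (φ k)).2.2 hx hy ha hb hab)
  · filter_upwards [hae, ae_restrict_mem₀ (hD.nullMeasurableSet (volume : Measure (E d)))] with x hx hxD
    exact tendsto_nhds_unique hx (hl x hxD)

theorem closure_SClass_subset {β : ℝ} (hD : Convex ℝ D) (hint : (interior D).Nonempty)
    (hu : 0 < u) : closure (SClass D u α β) ⊆ {g : L2 D | ∃ h : E d → ℝ, IsLipStrong D u α h ∧
      g =ᵐ[(volume : Measure (E d)).restrict D] h} := by
  refine closure_minimal ?_ (isClosed_lipStrong hD hint hu)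
  rintro g ⟨h, hh, e⟩
  exact ⟨h, ⟨fun x hx y hy => hh.lipschitz hD hx hy, hh.strongConvexOn hD hint⟩, e⟩

end ClosedClass

/-! ### Inverses of class `𝒦_∞` functions. -/

section InverseKInf

theorem invFunOn_of_isKInf {K : ℝ → ℝ} (hK : IsKInf K) :
    Set.InvOn (Function.invFunOn K (Set.Ici 0)) K (Set.Ici 0) (Set.Ici 0) ∧
      Set.MapsTo (Function.invFunOn K (Set.Ici 0)) (Set.Ici 0) (Set.Ici 0) ∧
      IsKInf (Function.invFunOn K (Set.Ici 0)) := by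
  obtain ⟨hmono, hcont, h0, htop⟩ := hK
  have hmaps : Set.MapsTo K (Set.Ici 0) (Set.Ici 0) := fun x hx => by
    have := hmono.monotoneOn Set.self_mem_Ici hx hx
    rwa [h0] at this
  have hsurj : Set.SurjOn K (Set.Ici 0) (Set.Ici 0) := fun y hy => by
    obtain ⟨b, hb0, hb⟩ :=
      ((eventually_ge_atTop (0 : ℝ)).and (htop.eventually_ge_atTop y)).exists
    have := intermediate_value_Icc hb0 (hcont.mono Set.Icc_subset_Ici_self)
    obtain ⟨x, hx, hxy⟩ := this ⟨by rw [h0]; exact hy, hb⟩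
    exact ⟨x, hx.1, hxy⟩
  set κ := Function.invFunOn K (Set.Ici 0)
  have hinv : Set.InvOn κ K (Set.Ici 0) (Set.Ici 0) := by
    have : Set.BijOn K (Set.Ici 0) (Set.Ici 0) := ⟨hmaps, hmono.injOn, hsurj⟩
    exact this.invOn_invFunOn
  have hκmaps : Set.MapsTo κ (Set.Ici 0) (Set.Ici 0) := hsurj.mapsTo_invFunOn
  have hκmono : StrictMonoOn κ (Set.Ici 0) := fun x hx y hy hxy => by
    rw [← hmono.lt_iff_lt (hκmaps hx) (hκmaps hy), hinv.2 hx, hinv.2 hy]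
    exact hxy
  refine ⟨hinv, hκmaps, hκmono, ?_, ?_, ?_⟩
  -- A monotone surjection of `[0, ∞)` onto itself has no jumps, hence is continuous.
  · have hmono' : Monotone (hκmaps.restrict κ (Set.Ici 0) (Set.Ici 0)) := fun x y hxy =>
      hκmono.monotoneOn x.2 y.2 hxy
    have hsurj' : Function.Surjective (hκmaps.restrict κ (Set.Ici 0) (Set.Ici 0)) := fun x =>
      ⟨⟨K x, hmaps x.2⟩, Subtype.ext (hinv.1 x.2)⟩
    rw [continuousOn_iff_continuous_domRestrict]
    exact continuous_subtype_val.comp (hmono'.continuous_of_surjective hsurj')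
  · have := hinv.1 (Set.self_mem_Ici (a := (0 : ℝ)))
    rwa [h0] at this
  · refine tendsto_atTop.2 fun b => ?_
    filter_upwards [eventually_ge_atTop (K (max b 0))] with y hy
    have hb : max b 0 ∈ Set.Ici (0 : ℝ) := Set.mem_Ici.2 (le_max_right _ _)
    have := hκmono.monotoneOn (hmaps hb) (le_trans (hmaps hb) hy) hy
    rw [hinv.1 hb] at this
    exact (le_max_left _ _).trans this

end InverseKInf

/-! ### Monotonicity, convexity and bounds for `mu`. -/

section Mu

variable {α β u : ℝ}

theorem mu_denominator_factor (r : ℝ) :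
    α * β * r ^ 2 + 2 * (β + α) * u * r + 4 * u ^ 2 = (α * r + 2 * u) * (β * r + 2 * u) := by
  ring

theorem mu_zero : mu α β u 0 = 0 := by simp [mu]

theorem mu_pos (hα : 0 < α) (hβ : 0 < β) (hu : 0 < u) {r : ℝ} (hr : 0 < r) :
    0 < mu α β u r := by
  unfold mu
  positivity

theorem mu_nonneg (hα : 0 ≤ α) (r : ℝ) : 0 ≤ mu α β u r := by
  unfold mu
  positivity

theorem continuousOn_mu (hα : 0 < α) (hβ : 0 < β) (hu : 0 < u) :
    ContinuousOn (mu α β u) (Set.Ici 0) := by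
  unfold mu
  refine ContinuousOn.div (by fun_prop) (by fun_prop) fun r hr => ?_
  have : (0 : ℝ) ≤ r := hr
  positivity

theorem mu_le_quadratic (hα : 0 < α) (hβ : 0 < β) (hu : 0 < u) {r : ℝ} (hr : 0 ≤ r) :
    mu α β u r ≤ α * r ^ 2 / (4 * u) := by
  unfold mu
  have : 2 * u ≤ √(α * β * r ^ 2 + 2 * (β + α) * u * r + 4 * u ^ 2) := by
    refine Real.le_sqrt_of_sq_le ?_
    have h1 : 0 ≤ α * β * r ^ 2 := by positivity
    have h2 : 0 ≤ 2 * (β + α) * u * r := by positivity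
    linarith
  exact div_le_div_of_nonneg_left (by positivity) (by positivity) (by linarith)

theorem mu_le_half (hα : 0 < α) (hαβ : α ≤ β) (hu : 0 < u) {r : ℝ} (hr : 0 ≤ r) :
    mu α β u r ≤ r / 2 := by
  have hβ := hα.trans_le hαβ
  have h : α * r ≤ √(α * β * r ^ 2 + 2 * (β + α) * u * r + 4 * u ^ 2) := by
    refine Real.le_sqrt_of_sq_le ?_
    have h1 : α * α * r ^ 2 ≤ α * β * r ^ 2 := by gcongr
    have h2 : 0 ≤ 2 * (β + α) * u * r := by positivity
    nlinarith [sq_nonneg u]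
  unfold mu
  rw [div_le_div_iff₀ (by positivity) two_pos]
  nlinarith [mul_le_mul_of_nonneg_left h hr]

theorem combo_sqrt_mul_le {a₁ b₁ a₂ b₂ s t : ℝ} (ha₁ : 0 ≤ a₁) (hb₁ : 0 ≤ b₁) (ha₂ : 0 ≤ a₂)
    (hb₂ : 0 ≤ b₂) (hs : 0 ≤ s) (ht : 0 ≤ t) :
    s * √(a₁ * b₁) + t * √(a₂ * b₂) ≤ √((s * a₁ + t * a₂) * (s * b₁ + t * b₂)) := by
  refine Real.le_sqrt_of_sq_le ?_
  have e₁ := Real.sq_sqrt (mul_nonneg ha₁ hb₁)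
  have e₂ := Real.sq_sqrt (mul_nonneg ha₂ hb₂)
  have h : 2 * (√(a₁ * b₁) * √(a₂ * b₂)) ≤ a₁ * b₂ + a₂ * b₁ := by
    rw [Real.sqrt_mul ha₁, Real.sqrt_mul ha₂]
    have f₁ := Real.sq_sqrt ha₁
    have f₂ := Real.sq_sqrt ha₂
    have f₃ := Real.sq_sqrt hb₁
    have f₄ := Real.sq_sqrt hb₂
    calc 2 * (√a₁ * √b₁ * (√a₂ * √b₂)) = 2 * (√a₁ * √b₂) * (√a₂ * √b₁) := by ring
      _ ≤ (√a₁ * √b₂) ^ 2 + (√a₂ * √b₁) ^ 2 := two_mul_le_add_sq _ _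
      _ = _ := by rw [mul_pow, mul_pow, f₁, f₂, f₃, f₄]
  calc (s * √(a₁ * b₁) + t * √(a₂ * b₂)) ^ 2
      = s ^ 2 * √(a₁ * b₁) ^ 2 + t ^ 2 * √(a₂ * b₂) ^ 2 +
          s * t * (2 * (√(a₁ * b₁) * √(a₂ * b₂))) := by ring
    _ ≤ s ^ 2 * (a₁ * b₁) + t ^ 2 * (a₂ * b₂) + s * t * (a₁ * b₂ + a₂ * b₁) := by
        rw [e₁, e₂]
        gcongr
    _ = _ := by ring

theorem sq_div_combo_le {x y v w s t : ℝ} (hv : 0 < v) (hw : 0 < w) (hs : 0 ≤ s) (ht : 0 ≤ t)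
    (hst : s + t = 1) :
    (s * x + t * y) ^ 2 / (s * v + t * w) ≤ s * (x ^ 2 / v) + t * (y ^ 2 / w) := by
  have hpos : 0 < s * v + t * w := by
    rcases hs.eq_or_lt with h | h
    · have : t = 1 := by linarith
      rw [← h, this]
      linarith
    · have : 0 ≤ t * w := by positivity
      have : 0 < s * v := by positivity
      linarith
  rw [div_le_iff₀ hpos]
  have hX : x ^ 2 / v * v = x ^ 2 := by field_simp
  have hY : y ^ 2 / w * w = y ^ 2 := by field_simp
  have hXY : 2 * (x * y) ≤ x ^ 2 / v * w + y ^ 2 / w * v := by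
    have : x ^ 2 / v * w + y ^ 2 / w * v - 2 * (x * y) = (x * w - y * v) ^ 2 / (v * w) := by
      field_simp
      ring
    have h2 : 0 ≤ (x * w - y * v) ^ 2 / (v * w) := by positivity
    linarith
  have e : (s * (x ^ 2 / v) + t * (y ^ 2 / w)) * (s * v + t * w) =
      s ^ 2 * (x ^ 2 / v * v) + t ^ 2 * (y ^ 2 / w * w) +
        s * t * (x ^ 2 / v * w + y ^ 2 / w * v) := by ring
  rw [e, hX, hY]
  nlinarith [mul_le_mul_of_nonneg_left hXY (mul_nonneg hs ht)]

/-- The denominator is twice the geometric mean of two affine functions, hence concave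
(`combo_sqrt_mul_le`); `(x, v) ↦ x²/v` is jointly convex (`sq_div_combo_le`) and decreasing in `v`.
-/
theorem convexOn_mu (hα : 0 < α) (hβ : 0 < β) (hu : 0 < u) :
    ConvexOn ℝ (Set.Ici 0) (mu α β u) := by
  refine ⟨convex_Ici 0, fun x hx y hy s t hs ht hst => ?_⟩
  have hx' : (0 : ℝ) ≤ x := hx
  have hy' : (0 : ℝ) ≤ y := hy
  simp only [smul_eq_mul]
  let w : ℝ → ℝ := fun r => √((α * r + 2 * u) * (β * r + 2 * u))
  have hmu : ∀ r, mu α β u r = α / 2 * (r ^ 2 / w r) := fun r => by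
    simp only [mu, mu_denominator_factor, w]
    ring
  have hw : ∀ r, 0 ≤ r → 0 < w r := fun r hr => by positivity
  have hwc : s * w x + t * w y ≤ w (s * x + t * y) := by
    refine (combo_sqrt_mul_le (by positivity) (by positivity) (by positivity) (by positivity)
      hs ht).trans (le_of_eq ?_)
    have ht' : t = 1 - s := by linarith
    simp only [w, ht']
    ring_nf
  have hpos : 0 < s * w x + t * w y := by
    have h1 := hw x hx'
    have h2 := hw y hy'
    rcases hs.eq_or_lt with h | h
    · have : t = 1 := by linarith
      rw [← h, this]
      linarith
    · have : 0 < s * w x := mul_pos h h1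
      have : 0 ≤ t * w y := mul_nonneg ht h2.le
      linarith
  rw [hmu, hmu, hmu]
  calc α / 2 * ((s * x + t * y) ^ 2 / w (s * x + t * y))
      ≤ α / 2 * ((s * x + t * y) ^ 2 / (s * w x + t * w y)) := by gcongr
    _ ≤ α / 2 * (s * (x ^ 2 / w x) + t * (y ^ 2 / w y)) := by
        gcongr
        exact sq_div_combo_le (hw x hx') (hw y hy') hs ht hst
    _ = _ := by ring

theorem mu_mul_le (hα : 0 < α) (hβ : 0 < β) (hu : 0 < u) {t r : ℝ} (ht : 0 ≤ t) (ht1 : t ≤ 1)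
    (hr : 0 ≤ r) : mu α β u (t * r) ≤ mu α β u r := by
  have := (convexOn_mu hα hβ hu).2 (Set.mem_Ici.2 hr) (Set.self_mem_Ici (a := (0 : ℝ))) ht
    (sub_nonneg.2 ht1) (by ring)
  simp only [smul_eq_mul, mul_zero, add_zero, mu_zero] at this
  exact this.trans (mul_le_of_le_one_left (mu_nonneg hα.le r) ht1)

theorem monotoneOn_mu (hα : 0 < α) (hβ : 0 < β) (hu : 0 < u) :
    MonotoneOn (mu α β u) (Set.Ici 0) := fun x hx y hy hxy => by
  have hx' : (0 : ℝ) ≤ x := hx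
  rcases hx'.eq_or_lt with h | h
  · rw [← h, mu_zero]
    exact mu_nonneg hα.le y
  · have hy' : 0 < y := h.trans_le hxy
    have := mu_mul_le hα hβ hu (t := x / y) (by positivity) ((div_le_one hy').2 hxy) hy'.le
    rwa [div_mul_cancel₀ _ hy'.ne'] at this

end Mu

/-! ### Inradius, diameter, and existence of portion constants. -/

section Inradius

variable {d : ℕ} {D : Set (E d)}

theorem two_mul_le_diam (hd : 0 < d) (hDcomp : IsCompact D) {c : E d} {r : ℝ} (hr : 0 ≤ r)
    (h : Metric.closedBall c r ⊆ D) : 2 * r ≤ Metric.diam D := by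
  have : Nonempty (Fin d) := ⟨⟨0, hd⟩⟩
  obtain ⟨v, hv⟩ := exists_norm_eq (E d) hr
  have h1 : c + v ∈ D := h (by simp [hv])
  have h2 : c - v ∈ D := h (by simp [hv])
  have := Metric.dist_le_diam_of_mem hDcomp.isBounded h1 h2
  rw [dist_eq_norm, show c + v - (c - v) = (2 : ℝ) • v by module, norm_smul, hv] at this
  simpa using this

theorem bddAbove_inradius (hd : 0 < d) (hDcomp : IsCompact D) :
    BddAbove {r : ℝ | 0 ≤ r ∧ ∃ c, Metric.closedBall c r ⊆ D} :=
  ⟨Metric.diam D / 2, fun r ⟨hr, c, hc⟩ => by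
    have := two_mul_le_diam hd hDcomp hr hc
    linarith⟩

theorem inradius_pos (hd : 0 < d) (hDcomp : IsCompact D) (hint : (interior D).Nonempty) :
    0 < inradius D := by
  obtain ⟨c, hc⟩ := hint
  obtain ⟨r, hr, hrD⟩ := Metric.nhds_basis_closedBall.mem_iff.1 (mem_interior_iff_mem_nhds.1 hc)
  exact lt_of_lt_of_le hr (le_csSup (bddAbove_inradius hd hDcomp) ⟨hr.le, c, hrD⟩)

theorem two_mul_inradius_le_diam (hd : 0 < d) (hDcomp : IsCompact D)
    (hint : (interior D).Nonempty) : 2 * inradius D ≤ Metric.diam D := by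
  have : inradius D ≤ Metric.diam D / 2 := by
    obtain ⟨c, hc⟩ := hint
    refine csSup_le ⟨0, le_rfl, c, ?_⟩ ?_
    · simpa using interior_subset hc
    · rintro r ⟨hr, c, hc⟩
      have := two_mul_le_diam hd hDcomp hr hc
      linarith
  linarith

theorem diam_pos (hd : 0 < d) (hDcomp : IsCompact D) (hint : (interior D).Nonempty) :
    0 < Metric.diam D := by
  have := inradius_pos hd hDcomp hint
  have := two_mul_inradius_le_diam hd hDcomp hint
  linarith

theorem volume_real_closedBall (hd : 0 < d) (x : E d) {r : ℝ} (hr : 0 ≤ r) :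
    (volume : Measure (E d)).real (Metric.closedBall x r) =
      r ^ d * (Real.pi ^ ((d : ℝ) / 2) / Real.Gamma ((d : ℝ) / 2 + 1)) := by
  have : Nonempty (Fin d) := ⟨⟨0, hd⟩⟩
  have hπ : √Real.pi ^ d = Real.pi ^ ((d : ℝ) / 2) := by
    rw [Real.sqrt_eq_rpow, ← Real.rpow_natCast, ← Real.rpow_mul Real.pi_pos.le]
    congr 1
    ring
  have hG : 0 < Real.Gamma ((d : ℝ) / 2 + 1) := Real.Gamma_pos_of_pos (by positivity)
  rw [Measure.real, EuclideanSpace.volume_closedBall, Fintype.card_fin, hπ, ENNReal.toReal_mul,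
    ENNReal.toReal_pow, ENNReal.toReal_ofReal hr, ENNReal.toReal_ofReal (by positivity)]

/-- The homothety with center `x` and ratio `t = r / R` maps a fixed ball `B(c, ρ) ⊆ D` into `D` by
convexity. In `R`, the terms `diam D + ρ` keep the image inside `B(x, r)`, and the inradius ensures
`t ≤ 1` and `ρ / R < 1`. -/
theorem exists_isPortionConst (hd : 0 < d) (hDconv : Convex ℝ D) (hDcomp : IsCompact D)
    (hint : (interior D).Nonempty) : ∃ lam, IsPortionConst D lam := by
  obtain ⟨c, hc⟩ := hint
  obtain ⟨ρ, hρ, hρD⟩ := Metric.nhds_basis_closedBall.mem_iff.1 (mem_interior_iff_mem_nhds.1 hc)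
  have hrD : 0 < inradius D := inradius_pos hd hDcomp ⟨c, hc⟩
  have hdiam : 0 ≤ Metric.diam D := Metric.diam_nonneg
  set R := Metric.diam D + ρ + inradius D with hR
  have hRpos : 0 < R := by positivity
  refine ⟨(ρ / R) ^ d, by positivity, pow_lt_one₀ (by positivity)
    ((div_lt_one hRpos).2 (by linarith)) hd.ne', fun x hx r hr => ?_⟩
  rcases lt_or_ge r 0 with hneg | hpos
  · rw [Metric.closedBall_eq_empty.2 hneg]
    simp
  set t := r / R with ht
  have ht0 : 0 ≤ t := by positivity
  have ht1 : t ≤ 1 := (div_le_one hRpos).2 (by linarith)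
  have hxc : ‖c - x‖ ≤ Metric.diam D := by
    rw [← dist_eq_norm]
    exact Metric.dist_le_diam_of_mem hDcomp.isBounded (interior_subset hc) hx
  have hsub : Metric.closedBall (x + t • (c - x)) (t * ρ) ⊆ Metric.closedBall x r ∩ D := by
    intro y hy
    rw [Metric.mem_closedBall, dist_eq_norm] at hy
    constructor
    · rw [Metric.mem_closedBall, dist_eq_norm]
      calc ‖y - x‖ = ‖(y - (x + t • (c - x))) + t • (c - x)‖ := by congr 1; abel
        _ ≤ t * ρ + t * Metric.diam D := by
            refine (norm_add_le _ _).trans (add_le_add hy ?_)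
            rw [norm_smul, Real.norm_of_nonneg ht0]
            gcongr
        _ = t * (Metric.diam D + ρ) := by ring
        _ ≤ t * R := by gcongr; linarith
        _ = r := by rw [ht]; field_simp
    · rcases ht0.eq_or_lt with h0 | h0
      · rw [← h0] at hy
        have : y = x := by simpa [sub_eq_zero] using hy
        rwa [this]
      · have hz : c + t⁻¹ • (y - (x + t • (c - x))) ∈ D := by
          apply hρD
          rw [Metric.mem_closedBall, dist_eq_norm, add_sub_cancel_left, norm_smul, norm_inv,
            Real.norm_of_nonneg ht0, inv_mul_le_iff₀ h0]
          exact hy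
        have := hDconv hx hz (sub_nonneg.2 ht1) ht0 (by ring)
        convert this using 1
        rw [smul_add, smul_smul, mul_inv_cancel₀ h0.ne']
        module
  calc (ρ / R) ^ d * (volume : Measure (E d)).real (Metric.closedBall x r)
      = (volume : Measure (E d)).real (Metric.closedBall (x + t • (c - x)) (t * ρ)) := by
        rw [volume_real_closedBall hd _ hpos, volume_real_closedBall hd _ (by positivity), ht]
        ring
    _ ≤ _ := measureReal_mono hsub
        (measure_ne_top_of_subset Set.inter_subset_left measure_closedBall_lt_top.ne)

end Inradius

/-! ### The modulus: class `𝒦_∞`, superadditivity of the inverse, convexity of its square. -/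

section KappaInv

variable {d : ℕ} {D : Set (E d)} {lam u α β : ℝ}

/-- The constant factor of `kappaInv ^ 2`. -/
noncomputable def kappaConst (D : Set (E d)) (lam α : ℝ) : ℝ :=
  α ^ 2 * Real.pi ^ ((d : ℝ) / 2) / (d * 2 ^ (d + 3) * Real.Gamma ((d : ℝ) / 2)) * lam *
    (inradius D / Metric.diam D) ^ d

theorem kappaConst_pos (hd : 0 < d) (hDcomp : IsCompact D) (hint : (interior D).Nonempty)
    (hlam : 0 < lam) (hα : 0 < α) : 0 < kappaConst D lam α := by
  have h1 := inradius_pos hd hDcomp hint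
  have h2 := diam_pos hd hDcomp hint
  have hd' : (0 : ℝ) < d := by exact_mod_cast hd
  have h3 : 0 < Real.Gamma ((d : ℝ) / 2) := Real.Gamma_pos_of_pos (by positivity)
  have h4 := Real.pi_pos
  unfold kappaConst
  positivity

theorem kappaInv_eq (r : ℝ) : kappaInv D lam u α β r =
    √(kappaConst D lam α * r ^ 4 * mu α β u r ^ d) := rfl

theorem kappaInv_nonneg (r : ℝ) : 0 ≤ kappaInv D lam u α β r := Real.sqrt_nonneg _

variable (hC : 0 < kappaConst D lam α) (hα : 0 < α) (hβ : 0 < β) (hu : 0 < u)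

include hC hα in
theorem kappaInv_sq (r : ℝ) : kappaInv D lam u α β r ^ 2 =
    kappaConst D lam α * r ^ 4 * mu α β u r ^ d := by
  have := mu_nonneg (β := β) (u := u) hα.le r
  rw [kappaInv_eq, Real.sq_sqrt (by positivity)]

include hC hα hβ hu

theorem isKInf_kappaInv : IsKInf (kappaInv D lam u α β) := by
  refine ⟨fun x hx y hy hxy => ?_, ?_, ?_, ?_⟩
  · have hx' : (0 : ℝ) ≤ x := hx
    have hm := monotoneOn_mu hα hβ hu hx hy hxy.le
    have hpos := mu_pos hα hβ hu (hx'.trans_lt hxy)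
    have hx0 := mu_nonneg (β := β) (u := u) hα.le x
    rw [kappaInv_eq, kappaInv_eq]
    refine Real.sqrt_lt_sqrt (by positivity) ?_
    calc kappaConst D lam α * x ^ 4 * mu α β u x ^ d
        ≤ kappaConst D lam α * x ^ 4 * mu α β u y ^ d := by gcongr
      _ < kappaConst D lam α * y ^ 4 * mu α β u y ^ d := by gcongr
  · have := continuousOn_mu hα hβ hu
    simp_rw [funext kappaInv_eq]
    fun_prop
  · simp [kappaInv_eq]
  · have h1 := mu_pos hα hβ hu one_pos
    have hc : 0 < kappaConst D lam α * mu α β u 1 ^ d := by positivity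
    have hlim : Tendsto (fun r : ℝ => √(kappaConst D lam α * mu α β u 1 ^ d * r ^ 4))
        atTop atTop :=
      Real.tendsto_sqrt_atTop.comp ((tendsto_pow_atTop (by norm_num)).const_mul_atTop hc)
    refine tendsto_atTop_mono' _ ?_ hlim
    filter_upwards [eventually_ge_atTop (1 : ℝ)] with r hr
    rw [kappaInv_eq]
    refine Real.sqrt_le_sqrt ?_
    have hm := monotoneOn_mu hα hβ hu (Set.mem_Ici.2 zero_le_one)
      (Set.mem_Ici.2 (zero_le_one.trans hr)) hr
    calc _ = kappaConst D lam α * r ^ 4 * mu α β u 1 ^ d := by ring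
      _ ≤ _ := by gcongr

/-- A product of nonnegative convex functions that increase together is convex. The square is what
Jensen's inequality needs, since the noise is controlled through its second moment. -/
theorem convexOn_kappaInv_sq :
    ConvexOn ℝ (Set.Ici 0) fun r => kappaInv D lam u α β r ^ 2 := by
  simp_rw [kappaInv_sq hC hα, mul_assoc]
  have h4 : ConvexOn ℝ (Set.Ici (0 : ℝ)) fun r : ℝ => r ^ 4 := convexOn_pow 4
  have hmu : ConvexOn ℝ (Set.Ici (0 : ℝ)) fun r : ℝ => mu α β u r ^ d :=
    (convexOn_mu hα hβ hu).pow (fun r _ => mu_nonneg hα.le r) d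
  refine ConvexOn.smul hC.le (ConvexOn.mul h4 hmu (fun r _ => by positivity)
    (fun r _ => pow_nonneg (mu_nonneg hα.le r) d) ?_)
  refine MonotoneOn.monovaryOn (fun x hx y hy hxy => ?_) (fun x hx y hy hxy => ?_)
  · exact pow_le_pow_left₀ hx hxy 4
  · exact pow_le_pow_left₀ (mu_nonneg hα.le x) (monotoneOn_mu hα hβ hu hx hy hxy) d

theorem kappaInv_mul_le {t r : ℝ} (ht : 0 ≤ t) (ht1 : t ≤ 1) (hr : 0 ≤ r) :
    kappaInv D lam u α β (t * r) ≤ t * kappaInv D lam u α β r := by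
  refine abs_le_of_sq_le_sq' ?_ (mul_nonneg ht (kappaInv_nonneg r)) |>.2
  have h0 := mu_nonneg (β := β) (u := u) hα.le (t * r)
  have h1 := mu_nonneg (β := β) (u := u) hα.le r
  rw [mul_pow, kappaInv_sq hC hα, kappaInv_sq hC hα]
  have hm := mu_mul_le hα hβ hu ht ht1 hr
  -- Of the factor `t⁴` under the root, only `t²` is needed.
  have ht2 : t ^ 2 ≤ 1 := pow_le_one₀ ht ht1
  calc kappaConst D lam α * (t * r) ^ 4 * mu α β u (t * r) ^ d
      ≤ kappaConst D lam α * (t * r) ^ 4 * mu α β u r ^ d := by gcongr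
    _ = t ^ 2 * (t ^ 2 * (kappaConst D lam α * r ^ 4 * mu α β u r ^ d)) := by ring
    _ ≤ t ^ 2 * (1 * (kappaConst D lam α * r ^ 4 * mu α β u r ^ d)) := by gcongr
    _ = _ := by ring

theorem kappaInv_add_le {x y : ℝ} (hx : 0 ≤ x) (hy : 0 ≤ y) :
    kappaInv D lam u α β x + kappaInv D lam u α β y ≤ kappaInv D lam u α β (x + y) := by
  rcases (add_nonneg hx hy).eq_or_lt with h | h
  · have hx0 : x = 0 := by linarith
    have hy0 : y = 0 := by linarith
    simp [hx0, hy0, kappaInv_eq]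
  · have h1 := kappaInv_mul_le hC hα hβ hu (t := x / (x + y)) (by positivity)
      ((div_le_one h).2 (by linarith)) h.le
    have h2 := kappaInv_mul_le hC hα hβ hu (t := y / (x + y)) (by positivity)
      ((div_le_one h).2 (by linarith)) h.le
    rw [div_mul_cancel₀ _ h.ne'] at h1 h2
    calc _ ≤ x / (x + y) * kappaInv D lam u α β (x + y) +
          y / (x + y) * kappaInv D lam u α β (x + y) := add_le_add h1 h2
      _ = _ := by field_simp

/-- With `r = κ(Z)` this bounds `κ(Z)` by an affine function of `Z²`, which makes it integrable. -/
theorem le_one_add_kappaInv_sq {r : ℝ} (hr : 0 ≤ r) :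
    r ≤ 1 + (kappaInv D lam u α β 1 ^ 2)⁻¹ * kappaInv D lam u α β r ^ 2 := by
  have hpos : 0 < kappaInv D lam u α β 1 := by
    have := (isKInf_kappaInv hC hα hβ hu).1 Set.self_mem_Ici (Set.mem_Ici.2 zero_le_one) one_pos
    rwa [(isKInf_kappaInv hC hα hβ hu).2.2.1] at this
  rcases le_total r 1 with h | h
  · have : 0 ≤ (kappaInv D lam u α β 1 ^ 2)⁻¹ * kappaInv D lam u α β r ^ 2 := by positivity
    linarith
  · have hr0 : 0 < r := by linarith
    have h1 := kappaInv_mul_le hC hα hβ hu (t := r⁻¹) (by positivity) (inv_le_one_of_one_le₀ h)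
      hr0.le
    rw [inv_mul_cancel₀ hr0.ne', le_inv_mul_iff₀ hr0] at h1
    have h2 : r * kappaInv D lam u α β 1 ^ 2 ≤ kappaInv D lam u α β r ^ 2 := by
      calc r * kappaInv D lam u α β 1 ^ 2 ≤ r ^ 2 * kappaInv D lam u α β 1 ^ 2 := by
            gcongr
            nlinarith
        _ = (r * kappaInv D lam u α β 1) ^ 2 := by ring
        _ ≤ _ := by gcongr
    have h3 : r ≤ (kappaInv D lam u α β 1 ^ 2)⁻¹ * kappaInv D lam u α β r ^ 2 := by
      rw [le_inv_mul_iff₀ (by positivity), mul_comm]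
      exact h2
    linarith

theorem isKInf_kappa : IsKInf (kappa D lam u α β) :=
  (invFunOn_of_isKInf (isKInf_kappaInv hC hα hβ hu)).2.2

theorem invOn_kappa :
    Set.InvOn (kappa D lam u α β) (kappaInv D lam u α β) (Set.Ici 0) (Set.Ici 0) :=
  (invFunOn_of_isKInf (isKInf_kappaInv hC hα hβ hu)).1

theorem kappa_nonneg {x : ℝ} (hx : 0 ≤ x) : 0 ≤ kappa D lam u α β x :=
  (invFunOn_of_isKInf (isKInf_kappaInv hC hα hβ hu)).2.1 hx

theorem kappaInv_kappa {x : ℝ} (hx : 0 ≤ x) :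
    kappaInv D lam u α β (kappa D lam u α β x) = x :=
  (invOn_kappa hC hα hβ hu).2 hx

theorem le_kappa_of_kappaInv_le {r x : ℝ} (hr : 0 ≤ r) (h : kappaInv D lam u α β r ≤ x) :
    r ≤ kappa D lam u α β x := by
  have hx := (kappaInv_nonneg r).trans h
  have := (isKInf_kappa hC hα hβ hu).1.monotoneOn (kappaInv_nonneg r) hx h
  rwa [(invOn_kappa hC hα hβ hu).1 hr] at this

theorem kappa_mono {x y : ℝ} (hx : 0 ≤ x) (hxy : x ≤ y) :
    kappa D lam u α β x ≤ kappa D lam u α β y :=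
  (isKInf_kappa hC hα hβ hu).1.monotoneOn hx (hx.trans hxy) hxy

theorem kappa_add_le {x y : ℝ} (hx : 0 ≤ x) (hy : 0 ≤ y) :
    kappa D lam u α β (x + y) ≤ kappa D lam u α β x + kappa D lam u α β y := by
  have h1 := kappa_nonneg hC hα hβ hu hx
  have h2 := kappa_nonneg hC hα hβ hu hy
  have h := kappaInv_add_le hC hα hβ hu h1 h2
  rw [kappaInv_kappa hC hα hβ hu hx, kappaInv_kappa hC hα hβ hu hy] at h
  have := kappa_mono hC hα hβ hu (add_nonneg hx hy) h
  rwa [(invOn_kappa hC hα hβ hu).1 (add_nonneg h1 h2)] at this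

end KappaInv

/-! ### A Lipschitz function large at one point has large `L₂` norm. -/

section LowerBound

variable {d : ℕ} {D : Set (E d)} {lam u α β : ℝ}

theorem norm_sq_L2 (g : L2 D) : ‖g‖ ^ 2 = ∫ x in D, g x ^ 2 := by
  rw [← real_inner_self_eq_norm_sq, L2.inner_def]
  refine integral_congr_ae (ae_of_all _ fun x => ?_)
  simp [pow_two]

theorem integrable_sq_L2 (g : L2 D) :
    Integrable (fun x => g x ^ 2) ((volume : Measure (E d)).restrict D) := by
  have := L2.integrable_inner (𝕜 := ℝ) g g
  refine this.congr (ae_of_all _ fun x => ?_)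
  simp [pow_two]

theorem two_mul_kappaInv_sq_le (hd : 0 < d) (hDcomp : IsCompact D)
    (hint : (interior D).Nonempty) (hlam : IsPortionConst D lam) (hα : 0 < α) (hαβ : α ≤ β)
    (hu : 0 < u) {h : E d → ℝ} (hh : ∀ x ∈ D, ∀ y ∈ D, |h x - h y| ≤ 2 * u * ‖x - y‖)
    {g : L2 D} (hg : g =ᵐ[(volume : Measure (E d)).restrict D] h) {x₀ : E d} (hx₀ : x₀ ∈ D)
    {r : ℝ} (hr : 0 ≤ r) (hrD : r ≤ Metric.diam D) (hval : α * r ^ 2 / 2 ≤ |h x₀|) :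
    2 * kappaInv D lam u α β r ^ 2 ≤ ‖g‖ ^ 2 := by
  have hβ := hα.trans_le hαβ
  have hI := inradius_pos hd hDcomp hint
  have hI2 := two_mul_inradius_le_diam hd hDcomp hint
  have hdiam := diam_pos hd hDcomp hint
  have hμ0 := mu_nonneg (β := β) (u := u) hα.le r
  set m := mu α β u r with hm
  -- This radius is below the inradius (by `mu_le_half` and `r ≤ diam D`) and so small that `h`
  -- changes by at most `αr²/8` (by `mu_le_quadratic`); thus `|h| ≥ 3αr²/8` on the ball.
  set ρ := inradius D / Metric.diam D * m / 2 with hρ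
  have hρ0 : 0 ≤ ρ := by positivity
  have hratio : inradius D / Metric.diam D ≤ 1 / 2 := by
    rw [div_le_div_iff₀ hdiam two_pos]
    linarith
  have hρI : ρ ≤ inradius D := by
    have h1 := mu_le_half hα hαβ hu hr
    rw [← hm] at h1
    calc ρ = inradius D * (m / (2 * Metric.diam D)) := by rw [hρ]; field_simp
      _ ≤ inradius D * 1 := by
          gcongr
          rw [div_le_one (by positivity)]
          linarith
      _ = _ := mul_one _
  have hρu : 2 * u * ρ ≤ α * r ^ 2 / 8 := by
    have h1 := mu_le_quadratic hα hβ hu hr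
    rw [← hm, le_div_iff₀ (by positivity)] at h1
    calc 2 * u * ρ = inradius D / Metric.diam D * (m * u) := by rw [hρ]; ring
      _ ≤ 1 / 2 * (m * u) := by gcongr
      _ ≤ _ := by linarith
  have hball : ∀ x ∈ Metric.closedBall x₀ ρ ∩ D, 9 / 64 * α ^ 2 * r ^ 4 ≤ h x ^ 2 := by
    rintro x ⟨hxB, hxD⟩
    rw [Metric.mem_closedBall, dist_comm, dist_eq_norm] at hxB
    have h1 := hh x₀ hx₀ x hxD
    have h2 := abs_sub_abs_le_abs_sub (h x₀) (h x)
    have h3 : 2 * u * ‖x₀ - x‖ ≤ 2 * u * ρ := by gcongr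
    have h4 : 3 / 8 * (α * r ^ 2) ≤ |h x| := by linarith
    calc 9 / 64 * α ^ 2 * r ^ 4 = (3 / 8 * (α * r ^ 2)) ^ 2 := by ring
      _ ≤ |h x| ^ 2 := by gcongr
      _ = h x ^ 2 := sq_abs _
  have hmarkov := mul_meas_ge_le_integral_of_nonneg (ae_of_all _ fun x => sq_nonneg (g x))
    (integrable_sq_L2 g) (9 / 64 * α ^ 2 * r ^ 4)
  have hmeas : (volume : Measure (E d)).real (Metric.closedBall x₀ ρ ∩ D) ≤
      ((volume : Measure (E d)).restrict D).real {x | 9 / 64 * α ^ 2 * r ^ 4 ≤ g x ^ 2} := by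
    have : IsFiniteMeasure ((volume : Measure (E d)).restrict D) :=
      ⟨by simpa using hDcomp.measure_lt_top⟩
    rw [Measure.real, Measure.real,
      ← Measure.restrict_apply Metric.isClosed_closedBall.measurableSet]
    refine ENNReal.toReal_mono (measure_ne_top _ _) (measure_mono_ae ?_)
    filter_upwards [hg, ae_restrict_mem hDcomp.isClosed.measurableSet] with x hx hxD hxB
    change 9 / 64 * α ^ 2 * r ^ 4 ≤ g x ^ 2
    rw [hx]
    exact hball x ⟨hxB, hxD⟩
  have hport := hlam.2.2 x₀ hx₀ ρ hρI
  rw [volume_real_closedBall hd _ hρ0] at hport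
  have hC := kappaConst_pos hd hDcomp hint hlam.1 hα
  have hconst : kappaConst D lam α * r ^ 4 * m ^ d * 16 = α ^ 2 * r ^ 4 *
      (lam * (ρ ^ d * (Real.pi ^ ((d : ℝ) / 2) / Real.Gamma ((d : ℝ) / 2 + 1)))) := by
    have hd' : (0 : ℝ) < d := by exact_mod_cast hd
    have hG : 0 < Real.Gamma ((d : ℝ) / 2) := Real.Gamma_pos_of_pos (by positivity)
    rw [Real.Gamma_add_one (by positivity), hρ, kappaConst]
    simp only [div_pow, mul_pow]
    field_simp
    ring
  have hnonneg : 0 ≤ kappaConst D lam α * r ^ 4 * m ^ d := by positivity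
  calc 2 * kappaInv D lam u α β r ^ 2 = 2 * (kappaConst D lam α * r ^ 4 * m ^ d) := by
        rw [kappaInv_sq hC hα]
    -- Here `16 · 9/64 = 9/4` exceeds the required 2.
    _ ≤ 9 / 64 * (kappaConst D lam α * r ^ 4 * m ^ d * 16) := by linarith
    _ = 9 / 64 * α ^ 2 * r ^ 4 *
        (lam * (ρ ^ d * (Real.pi ^ ((d : ℝ) / 2) / Real.Gamma ((d : ℝ) / 2 + 1)))) := by
        rw [hconst]
        ring
    _ ≤ 9 / 64 * α ^ 2 * r ^ 4 *
        ((volume : Measure (E d)).restrict D).real {x | 9 / 64 * α ^ 2 * r ^ 4 ≤ g x ^ 2} := by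
        gcongr
        exact hport.trans hmeas
    _ ≤ _ := by
        rw [norm_sq_L2]
        exact hmarkov

end LowerBound

/-! ### Quadratic growth at minimizers. -/

section Minimizers

variable {d n : ℕ} {D X : Set (E d)} {u α : ℝ}

theorem strongConvexOn_sum {h : Fin n → E d → ℝ} (hn : 0 < n)
    (hh : ∀ i, StrongConvexOn D α (h i)) :
    StrongConvexOn D (n * α) fun x => ∑ i, h i x := by
  refine ⟨(hh ⟨0, hn⟩).1, fun x hx y hy a b ha hb hab => ?_⟩
  refine (Finset.sum_le_sum fun i _ => (hh i).2 hx hy ha hb hab).trans (le_of_eq ?_)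
  simp only [smul_eq_mul, Finset.sum_sub_distrib, Finset.sum_add_distrib, Finset.mul_sum,
    Finset.sum_const, Finset.card_univ, Fintype.card_fin, nsmul_eq_mul]
  ring

/-- Comparing `x` with the point at parameter `t` on the segment to `y`, dividing by `t` and letting
`t → 0⁺` recovers the full constant `α / 2`. -/
theorem quadratic_growth_of_strongConvexOn {F : E d → ℝ} (hF : StrongConvexOn D α F) (hXD : X ⊆ D)
    (hX : Convex ℝ X) {x : E d} (hx : x ∈ X) (hmin : ∀ y ∈ X, F x ≤ F y) {y : E d} (hy : y ∈ X) :
    F x + α / 2 * ‖x - y‖ ^ 2 ≤ F y := by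
  have key : ∀ t ∈ Set.Ioc (0 : ℝ) 1, F x + (1 - t) * (α / 2 * ‖x - y‖ ^ 2) ≤ F y := by
    intro t ht
    have hmem := hX hx hy (sub_nonneg.2 ht.2) ht.1.le (by ring)
    have h1 := hmin _ hmem
    have h2 := hF.2 (hXD hx) (hXD hy) (sub_nonneg.2 ht.2) ht.1.le (by ring)
    simp only [smul_eq_mul] at h2
    have h3 : t * (F x + (1 - t) * (α / 2 * ‖x - y‖ ^ 2)) ≤ t * F y := by
      linarith
    exact le_of_mul_le_mul_left h3 ht.1
  have hlim : Tendsto (fun t : ℝ => F x + (1 - t) * (α / 2 * ‖x - y‖ ^ 2)) (𝓝[>] 0)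
      (𝓝 (F x + α / 2 * ‖x - y‖ ^ 2)) := by
    have hc : Continuous fun t : ℝ => F x + (1 - t) * (α / 2 * ‖x - y‖ ^ 2) := by fun_prop
    have := (hc.tendsto 0).mono_left (nhdsWithin_le_nhds (s := Set.Ioi 0))
    simpa using this
  refine le_of_tendsto hlim ?_
  filter_upwards [Ioc_mem_nhdsGT one_pos] with t ht using key t ht

theorem exists_min_quadratic_growth (hn : 0 < n) (hu : 0 < u) (hDcomp : IsCompact D)
    (hXD : X ⊆ D) (hX : Convex ℝ X) (hXclosed : IsClosed X) (hXne : X.Nonempty)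
    {h : Fin n → E d → ℝ} (hh : ∀ i, IsLipStrong D u α (h i)) :
    ∃ x ∈ X, ∀ y ∈ X, ∑ i, h i x + n * α / 2 * ‖x - y‖ ^ 2 ≤ ∑ i, h i y := by
  have hXcomp : IsCompact X := hDcomp.of_isClosed_subset hXclosed hXD
  have hcont : ContinuousOn (fun x => ∑ i, h i x) X :=
    continuousOn_finsetSum _ fun i _ => ((hh i).continuousOn hu.le).mono hXD
  obtain ⟨x, hx, hmin⟩ := hXcomp.exists_isMinOn hXne hcont
  exact ⟨x, hx, fun y hy =>
    quadratic_growth_of_strongConvexOn (strongConvexOn_sum hn fun i => (hh i).2) hXD hX hx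
      (fun z hz => hmin hz) hy⟩

/-- Adding the two growth inequalities cancels the common summands and bounds below the change of `h
i₀ - h' i₀` between `x` and `y`; one endpoint carries at least half of it. -/
theorem exists_large_difference {h h' : Fin n → E d → ℝ} {i₀ : Fin n}
    (hne : ∀ i, i ≠ i₀ → h i = h' i) {x y : E d} (hx : x ∈ X) (hy : y ∈ X) {a : ℝ}
    (hxmin : ∀ z ∈ X, ∑ i, h i x + a / 2 * ‖x - z‖ ^ 2 ≤ ∑ i, h i z)
    (hymin : ∀ z ∈ X, ∑ i, h' i y + a / 2 * ‖y - z‖ ^ 2 ≤ ∑ i, h' i z) :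
    ∃ z ∈ X, a * ‖x - y‖ ^ 2 / 2 ≤ |h i₀ z - h' i₀ z| := by
  have hsum : ∀ z, ∑ i, h i z - ∑ i, h' i z = h i₀ z - h' i₀ z := fun z => by
    rw [← Finset.sum_sub_distrib]
    refine Finset.sum_eq_single i₀ (fun i _ hi => ?_) (by simp)
    rw [hne i hi, sub_self]
  have h1 := hxmin y hy
  have h2 := hymin x hx
  rw [norm_sub_rev y x] at h2
  have e1 := hsum x
  have e2 := hsum y
  have h3 : a * ‖x - y‖ ^ 2 ≤ (h i₀ y - h' i₀ y) - (h i₀ x - h' i₀ x) := by linarith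
  by_cases hc : a * ‖x - y‖ ^ 2 / 2 ≤ |h i₀ y - h' i₀ y|
  · exact ⟨y, hy, hc⟩
  · refine ⟨x, hx, ?_⟩
    have h4 := le_abs_self (h i₀ y - h' i₀ y)
    have h5 := neg_abs_le (h i₀ x - h' i₀ x)
    linarith

end Minimizers

/-! ### Stability of the argmin in `L₂`. -/

section Stability

variable {d n : ℕ} {D X : Set (E d)} {lam u α β : ℝ}

theorem dist_argmin_le_of_ne (hd : 0 < d) (hn : 0 < n)
    (hDcomp : IsCompact D) (hint : (interior D).Nonempty) (hXD : X ⊆ D)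
    (hlam : IsPortionConst D lam) (hα : 0 < α) (hαβ : α ≤ β) (hu : 0 < u)
    {g g' : Fin n → L2 D} {h h' : Fin n → E d → ℝ}
    (hh : ∀ i, IsLipStrong D u α (h i)) (hh' : ∀ i, IsLipStrong D u α (h' i))
    (hg : ∀ i, g i =ᵐ[(volume : Measure (E d)).restrict D] h i)
    (hg' : ∀ i, g' i =ᵐ[(volume : Measure (E d)).restrict D] h' i)
    {i₀ : Fin n} (hne : ∀ i, i ≠ i₀ → h i = h' i) {x y : E d} (hx : x ∈ X) (hy : y ∈ X)
    (hxmin : ∀ z ∈ X, ∑ i, h i x + n * α / 2 * ‖x - z‖ ^ 2 ≤ ∑ i, h i z)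
    (hymin : ∀ z ∈ X, ∑ i, h' i y + n * α / 2 * ‖y - z‖ ^ 2 ≤ ∑ i, h' i z) :
    ‖x - y‖ ≤ kappa D lam u (n * α) (n * β) (‖g i₀ - g' i₀‖ / √2) := by
  have hn' : (0 : ℝ) < n := by exact_mod_cast hn
  have hnα : 0 < n * α := by positivity
  have hnαβ : n * α ≤ n * β := by gcongr
  have hC := kappaConst_pos hd hDcomp hint hlam.1 hnα
  obtain ⟨z, hz, hval⟩ := exists_large_difference hne hx hy hxmin hymin
  have hdiff : g i₀ - g' i₀ =ᵐ[(volume : Measure (E d)).restrict D] fun x => h i₀ x - h' i₀ x := by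
    filter_upwards [Lp.coeFn_sub (g i₀) (g' i₀), hg i₀, hg' i₀] with x e₁ e₂ e₃
    rw [e₁, Pi.sub_apply, e₂, e₃]
  have hlip : ∀ x ∈ D, ∀ y ∈ D, |(h i₀ x - h' i₀ x) - (h i₀ y - h' i₀ y)| ≤ 2 * u * ‖x - y‖ := by
    intro x hx y hy
    have h1 := (hh i₀).1 x hx y hy
    have h2 := (hh' i₀).1 x hx y hy
    calc |(h i₀ x - h' i₀ x) - (h i₀ y - h' i₀ y)|
        = |(h i₀ x - h i₀ y) - (h' i₀ x - h' i₀ y)| := by congr 1; ring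
      _ ≤ |h i₀ x - h i₀ y| + |h' i₀ x - h' i₀ y| := abs_sub _ _
      _ ≤ _ := by linarith
  have hrD : ‖x - y‖ ≤ Metric.diam D := by
    rw [← dist_eq_norm]
    exact Metric.dist_le_diam_of_mem hDcomp.isBounded (hXD hx) (hXD hy)
  have key := two_mul_kappaInv_sq_le hd hDcomp hint hlam hnα hnαβ hu hlip hdiff (hXD hz)
    (norm_nonneg _) hrD hval
  refine le_kappa_of_kappaInv_le hC hnα (hnα.trans_le hnαβ) hu (norm_nonneg _) ?_
  rw [le_div_iff₀ (by positivity)]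
  refine abs_le_of_sq_le_sq' ?_ (norm_nonneg _) |>.2
  rw [mul_pow, Real.sq_sqrt zero_le_two]
  linarith

theorem exists_argmin_selection (hd : 0 < d) (hn : 0 < n) (hDconv : Convex ℝ D)
    (hDcomp : IsCompact D) (hint : (interior D).Nonempty) (hXD : X ⊆ D) (hX : Convex ℝ X)
    (hXclosed : IsClosed X) (hXne : X.Nonempty) (hα : 0 < α) (hαβ : α ≤ β) (hu : 0 < u) :
    ∃ a : (Fin n → L2 D) → E d, (∀ g, a g ∈ X) ∧
      (∀ g : Fin n → L2 D, (∀ i, g i ∈ closure (SClass D u α β)) → IsArgmin D X g (a g)) ∧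
      ∀ lam, IsPortionConst D lam → ∀ g g' : Fin n → L2 D,
        (∀ i, g i ∈ closure (SClass D u α β)) → (∀ i, g' i ∈ closure (SClass D u α β)) →
        ‖a g' - a g‖ ≤ ∑ i, kappa D lam u (n * α) (n * β) (‖g' i - g i‖ / √2) := by
  classical
  -- The representative depends on the class alone, so tuples with equal entries in `L₂` have equal
  -- functions there.
  choose! rep hrep hae using fun (g : L2 D) (hg : g ∈ closure (SClass D u α β)) =>
    closure_SClass_subset hDconv hint hu hg
  have hmin : ∀ g : Fin n → L2 D, ∃ x ∈ X, (∀ i, g i ∈ closure (SClass D u α β)) →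
      ∀ y ∈ X, ∑ i, rep (g i) x + n * α / 2 * ‖x - y‖ ^ 2 ≤ ∑ i, rep (g i) y := by
    intro g
    by_cases hg : ∀ i, g i ∈ closure (SClass D u α β)
    · obtain ⟨x, hx, h⟩ := exists_min_quadratic_growth hn hu hDcomp hXD hX hXclosed hXne
        fun i => hrep (g i) (hg i)
      exact ⟨x, hx, fun _ => h⟩
    · obtain ⟨x, hx⟩ := hXne
      exact ⟨x, hx, fun h => absurd h hg⟩
  choose a haX ha using hmin
  have hn' : (0 : ℝ) < n := by exact_mod_cast hn
  refine ⟨a, haX, fun g hg => ⟨fun i => rep (g i), fun i =>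
    ⟨(hrep _ (hg i)).continuousOn hu.le, hae _ (hg i)⟩, haX g, fun y hy hne => ?_⟩, ?_⟩
  · have h1 := ha g hg y hy
    have h2 : 0 < ‖a g - y‖ := norm_pos_iff.2 (sub_ne_zero.2 hne.symm)
    have h3 : 0 < n * α / 2 * ‖a g - y‖ ^ 2 := by positivity
    linarith
  · intro lam hlam g g' hg hg'
    have hmem : ∀ (S : Finset (Fin n)) (i : Fin n),
        S.piecewise g' g i ∈ closure (SClass D u α β) := fun S i => by
      by_cases hi : i ∈ S
      · rw [Finset.piecewise_eq_of_mem _ _ _ hi]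
        exact hg' i
      · rw [Finset.piecewise_eq_of_notMem _ _ _ hi]
        exact hg i
    -- The entries of `g` are replaced by those of `g'` one at a time; every intermediate tuple
    -- stays in the closure of `𝒮`.
    have hind : ∀ S : Finset (Fin n), ‖a (S.piecewise g' g) - a g‖ ≤
        ∑ i ∈ S, kappa D lam u (n * α) (n * β) (‖g' i - g i‖ / √2) := by
      intro S
      induction S using Finset.induction_on with
      | empty => simp
      | insert j S hj ih =>
        have hstep := dist_argmin_le_of_ne hd hn hDcomp hint hXD hlam hα hαβ hu
          (fun i => hrep _ (hmem (insert j S) i)) (fun i => hrep _ (hmem S i))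
          (fun i => hae _ (hmem (insert j S) i)) (fun i => hae _ (hmem S i)) (i₀ := j)
          (fun i hi => by
            rw [Finset.piecewise_insert, Function.update_of_ne hi])
          (haX _) (haX _) (ha _ (hmem (insert j S))) (ha _ (hmem S))
        rw [Finset.piecewise_eq_of_mem _ _ _ (Finset.mem_insert_self j S),
          Finset.piecewise_eq_of_notMem _ _ _ hj] at hstep
        rw [Finset.sum_insert hj]
        calc _ ≤ ‖a ((insert j S).piecewise g' g) - a (S.piecewise g' g)‖ +
              ‖a (S.piecewise g' g) - a g‖ := norm_sub_le_norm_sub_add_norm_sub _ _ _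
          _ ≤ _ := add_le_add hstep ih
    have := hind Finset.univ
    rwa [Finset.piecewise_univ] at this

end Stability

/-! ### Jensen's inequality for the modulus. -/

section Expectation

variable {d : ℕ} {D : Set (E d)} {lam u α β : ℝ} {Ω : Type*} [MeasurableSpace Ω]
  {P : Measure Ω} [IsProbabilityMeasure P]

theorem kappa_integral_le (hC : 0 < kappaConst D lam α) (hα : 0 < α) (hβ : 0 < β) (hu : 0 < u)
    {Z : Ω → ℝ} (hZm : Measurable Z) (hZ : ∀ ω, 0 ≤ Z ω) (hZi : Integrable (fun ω => Z ω ^ 2) P)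
    {v : ℝ} (hv : 0 ≤ v) (hle : ∫ ω, Z ω ^ 2 ∂P ≤ v ^ 2) :
    Integrable (fun ω => kappa D lam u α β (Z ω)) P ∧
      ∫ ω, kappa D lam u α β (Z ω) ∂P ≤ kappa D lam u α β v := by
  have hmono := (isKInf_kappa hC hα hβ hu).1.monotoneOn
  have hW0 : ∀ ω, 0 ≤ kappa D lam u α β (Z ω) := fun ω => kappa_nonneg hC hα hβ hu (hZ ω)
  have hKW : ∀ ω, kappaInv D lam u α β (kappa D lam u α β (Z ω)) = Z ω := fun ω =>
    kappaInv_kappa hC hα hβ hu (hZ ω)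
  have hWm : Measurable fun ω => kappa D lam u α β (Z ω) := by
    -- `kappa` is meaningful only on `[0, ∞)`; precomposing with `max · 0` gives a monotone, hence
    -- measurable, function on all of `ℝ`.
    have hm : Monotone fun x : ℝ => kappa D lam u α β (max x 0) := fun x y hxy =>
      hmono (Set.mem_Ici.2 (le_max_right _ _)) (Set.mem_Ici.2 (le_max_right _ _))
        (max_le_max_right 0 hxy)
    have := hm.measurable.comp hZm
    simpa only [Function.comp_def, max_eq_left (hZ _)] using this
  have hWi : Integrable (fun ω => kappa D lam u α β (Z ω)) P := by
    refine Integrable.mono' ((integrable_const (1 : ℝ)).add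
      (hZi.const_mul (kappaInv D lam u α β 1 ^ 2)⁻¹)) hWm.aestronglyMeasurable
      (ae_of_all _ fun ω => ?_)
    rw [Real.norm_of_nonneg (hW0 ω)]
    have := le_one_add_kappaInv_sq hC hα hβ hu (hW0 ω)
    rwa [hKW] at this
  refine ⟨hWi, ?_⟩
  have hcont : ContinuousOn (fun r => kappaInv D lam u α β r ^ 2) (Set.Ici 0) :=
    (isKInf_kappaInv hC hα hβ hu).2.1.pow 2
  -- Applied to `W = κ(Z)`, this reads `κ⁻¹(E W)² ≤ E Z²`.
  have hJ := (convexOn_kappaInv_sq hC hα hβ hu).map_integral_le hcont isClosed_Ici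
    (ae_of_all P fun ω => Set.mem_Ici.2 (hW0 ω)) hWi (by
      refine hZi.congr (ae_of_all _ fun ω => ?_)
      simp only [Function.comp, hKW])
  simp only [hKW] at hJ
  refine le_kappa_of_kappaInv_le hC hα hβ hu (integral_nonneg hW0) ?_
  exact abs_le_of_sq_le_sq' (hJ.trans hle) hv |>.2

end Expectation

end PrivOpt

/-! ### The main theorem. -/

theorem mainTheorem3 {d n : ℕ} (hd : 0 < d) (hn : 0 < n)
    -- the domain, the feasible set and the class of objective functions
    (D X : Set (PrivOpt.E d)) (hDconv : Convex ℝ D) (hDcomp : IsCompact D)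
    (hDint : (interior D).Nonempty)
    (hXD : X ⊆ D) (hXconv : Convex ℝ X) (hXclosed : IsClosed X) (hXne : X.Nonempty)
    (u α β : ℝ) (hu : 0 < u) (hα : 0 < α) (hαβ : α < β)
    (f : Fin n → PrivOpt.L2 D) (hf : ∀ i, f i ∈ PrivOpt.SClass D u α β)
    -- the orthonormal basis and the noise
    (e : HilbertBasis ℕ ℝ (PrivOpt.L2 D))
    (q γ p : Fin n → ℝ) (hq : ∀ i, 1 < q i) (hγ : ∀ i, 0 < γ i)
    (hp : ∀ i, 1 / 2 < p i ∧ p i < q i - 1 / 2)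
    {Ω : Type*} [MeasurableSpace Ω] (P : Measure Ω) [IsProbabilityMeasure P]
    (η : Fin n → ℕ → Ω → ℝ) (hη : ∀ i k, Measurable (η i k))
    (hindep : iIndepFun (fun (ik : Fin n × ℕ) => η ik.1 ik.2) P)
    (hlaw : ∀ i k, P.map (η i k) = PrivOpt.laplace (γ i / ((k : ℝ) + 1) ^ p i))
    -- the smoothing step
    (ε : Fin n → ℝ) (s : Fin n → PrivOpt.L2 D → PrivOpt.L2 D) (hsmeas : ∀ i, Measurable (s i))
    (hs : ∀ i g, s i g ∈ PrivOpt.C2Class D ∧ ‖g - s i g‖ < ε i)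
    -- the distributed algorithm, which converges to the optimizer of the perturbed problem
    (G : Digraph (Fin n)) {State Msg : Type*} [MeasurableSpace State] [MeasurableSpace Msg]
    (A : PrivOpt.DistAlg D G State Msg) (z : Fin n → State)
    (hconv : ∀ᵐ ω ∂P, ∀ x,
      PrivOpt.IsArgmin D X (PrivOpt.perturbed u α β e s f fun i k => η i k ω) x →
      ∀ i, Tendsto
        (fun t => A.estimate i (A.run z (PrivOpt.perturbed u α β e s f fun i k => η i k ω) t i))
        atTop (𝓝 x)) :
    -- the noise is almost surely square summable
    (∀ᵐ ω ∂P, ∀ i, Memℓp (fun k => η i k ω) 2) ∧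
    -- privacy of the perturbed functions and of the messages exchanged from any initial states
    PrivOpt.IsDiffPrivate e q P
      (fun F ω => PrivOpt.perturbed u α β e s F fun i k => η i k ω)
      (fun i => Real.sqrt (riemannZeta ((2 * (q i - p i) : ℝ) : ℂ)).re / γ i) ∧
    (∀ z' : Fin n → State, PrivOpt.IsDiffPrivate e q P
      (fun F ω => A.transcript z' (PrivOpt.perturbed u α β e s F fun i k => η i k ω))
      (fun i => Real.sqrt (riemannZeta ((2 * (q i - p i) : ℝ) : ℂ)).re / γ i)) ∧
    -- accuracy of the output `xt` of the algorithm with respect to the true optimizer `xs`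
    (∃ lam, PrivOpt.IsPortionConst D lam) ∧
    ∃ (xs : PrivOpt.E d) (xt : Ω → PrivOpt.E d),
      PrivOpt.IsArgmin D X f xs ∧
      (∀ᵐ ω ∂P,
        PrivOpt.IsArgmin D X (PrivOpt.perturbed u α β e s f fun i k => η i k ω) (xt ω) ∧
        ∀ i, Tendsto
          (fun t => A.estimate i (A.run z (PrivOpt.perturbed u α β e s f fun i k => η i k ω) t i))
          atTop (𝓝 (xt ω))) ∧
      Integrable (fun ω => ‖xt ω - xs‖) P ∧
      ∀ lam, PrivOpt.IsPortionConst D lam →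
        PrivOpt.IsKInf (PrivOpt.kappa D lam u (n * α) (n * β)) ∧
        Set.InvOn (PrivOpt.kappa D lam u (n * α) (n * β))
          (PrivOpt.kappaInv D lam u (n * α) (n * β)) (Set.Ici 0) (Set.Ici 0) ∧
        ∫ ω, ‖xt ω - xs‖ ∂P ≤
          ∑ i, (PrivOpt.kappa D lam u (n * α) (n * β)
              (γ i * Real.sqrt (riemannZeta ((2 * p i : ℝ) : ℂ)).re) +
            PrivOpt.kappa D lam u (n * α) (n * β) (ε i)) := by
  have hβ : 0 < β := hα.trans hαβ
  have hSconv := (PrivOpt.convex_SClass (u := u) (α := α) (β := β) hDconv hDint).closure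
  have hSne : (closure (PrivOpt.SClass D u α β)).Nonempty := ⟨f ⟨0, hn⟩, subset_closure (hf _)⟩
  have hprojc := PrivOpt.continuous_proj hSne isClosed_closure hSconv
  have hproj : Measurable (PrivOpt.proj (closure (PrivOpt.SClass D u α β))) := hprojc.measurable
  have hηmeas : Measurable fun ω => fun i k => η i k ω :=
    measurable_pi_iff.2 fun i => measurable_pi_iff.2 fun k => hη i k
  obtain ⟨a, haX, ha, hstab⟩ := PrivOpt.exists_argmin_selection (n := n) (u := u) (α := α)
    (β := β) hd hn hDconv hDcomp hDint hXD hXconv hXclosed hXne hα hαβ.le hu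
  have hfS : ∀ i, f i ∈ closure (PrivOpt.SClass D u α β) := fun i => subset_closure (hf i)
  set F : Ω → Fin n → PrivOpt.L2 D :=
    fun ω => PrivOpt.perturbed u α β e s f fun i k => η i k ω
  have hFS : ∀ ω i, F ω i ∈ closure (PrivOpt.SClass D u α β) := fun ω i =>
    (PrivOpt.proj_spec hSne isClosed_closure hSconv _).1
  have hFm : Measurable F := (PrivOpt.measurable_perturbed e hproj hsmeas f).comp hηmeas
  have hlim : ∀ᵐ ω ∂P, ∀ i, Tendsto (fun t => A.estimate i (A.run z (F ω) t i)) atTop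
      (𝓝 (a (F ω))) := by
    filter_upwards [hconv] with ω hω using hω _ (ha _ (hFS ω))
  have hbound : ∀ ω, ‖a (F ω) - a f‖ ≤ Metric.diam D := fun ω => by
    rw [← dist_eq_norm]
    exact Metric.dist_le_diam_of_mem hDcomp.isBounded (hXD (haX _)) (hXD (haX _))
  -- The selection `a` is built by choice, so measurability comes from elsewhere: `a (F ω)` is the
  -- almost sure limit of the measurable estimates of one agent.
  have ham : AEStronglyMeasurable (fun ω => a (F ω)) P := by
    refine aestronglyMeasurable_of_tendsto_ae atTop (f := fun t ω =>
      A.estimate ⟨0, hn⟩ (A.run z (F ω) t ⟨0, hn⟩)) (fun t => ?_)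
      (hlim.mono fun ω hω => hω ⟨0, hn⟩)
    exact ((A.measurable_estimate _).comp
      ((A.measurable_run z t _).comp hFm)).aestronglyMeasurable
  have hint : Integrable (fun ω => ‖a (F ω) - a f‖) P :=
    Integrable.of_bound (ham.sub aestronglyMeasurable_const).norm (Metric.diam D)
      (ae_of_all _ fun ω => by rw [norm_norm]; exact hbound ω)
  refine ⟨ae_all_iff.2 fun i => PrivOpt.ae_memlp_noise (hγ i) (hp i).1 (hη i) (hlaw i),
    PrivOpt.isDiffPrivate_perturbed e hproj hγ hp hη hindep hlaw hsmeas (T := id) measurable_id,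
    fun z' => PrivOpt.isDiffPrivate_perturbed e hproj hγ hp hη hindep hlaw hsmeas
      (A.measurable_transcript z'),
    PrivOpt.exists_isPortionConst hd hDconv hDcomp hDint,
    a f, fun ω => a (F ω), ha f hfS, ?_, hint, fun lam hlam => ?_⟩
  · filter_upwards [hlim] with ω hω using ⟨ha _ (hFS ω), hω⟩
  have hn' : (0 : ℝ) < n := by exact_mod_cast hn
  have hnα : 0 < n * α := by positivity
  have hnβ : 0 < n * β := by positivity
  have hC := PrivOpt.kappaConst_pos hd hDcomp hDint hlam.1 hnα
  refine ⟨PrivOpt.isKInf_kappa hC hnα hnβ hu, PrivOpt.invOn_kappa hC hnα hnβ hu, ?_⟩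
  have hε : ∀ i, 0 ≤ ε i := fun i => (norm_nonneg _).trans (hs i 0).2.le
  have hdist : ∀ ω i, ‖F ω i - f i‖ ≤ ‖PrivOpt.Phi e fun k => η i k ω‖ + ε i := by
    intro ω i
    set φ := PrivOpt.Phi e fun k => η i k ω
    have h1 := PrivOpt.norm_proj_sub_proj_le hSne isClosed_closure hSconv (s i (f i + φ)) (f i)
    rw [PrivOpt.proj_of_mem hSne isClosed_closure hSconv (hfS i)] at h1
    have h2 := (hs i (f i + φ)).2
    rw [norm_sub_rev] at h2
    calc ‖F ω i - f i‖ ≤ ‖s i (f i + φ) - f i‖ := h1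
      _ = ‖(s i (f i + φ) - (f i + φ)) + φ‖ := by congr 1; abel
      _ ≤ ‖s i (f i + φ) - (f i + φ)‖ + ‖φ‖ := norm_add_le _ _
      _ ≤ ‖φ‖ + ε i := by linarith
  -- The division by `√2`, provided by the stability estimate, cancels the 2 in the variance.
  let Z : Fin n → Ω → ℝ := fun i ω => ‖PrivOpt.Phi e fun k => η i k ω‖ / √2
  have hZ0 : ∀ i ω, 0 ≤ Z i ω := fun i ω => by positivity
  have hZsq : ∀ i ω, Z i ω ^ 2 = ‖PrivOpt.Phi e fun k => η i k ω‖ ^ 2 / 2 := fun i ω => by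
    rw [div_pow, Real.sq_sqrt zero_le_two]
  have hζ : ∀ i, 0 ≤ (riemannZeta ((2 * p i : ℝ) : ℂ)).re := fun i =>
    (PrivOpt.hasSum_zeta (x := 2 * p i) (by linarith [(hp i).1])).nonneg fun k => by positivity
  have hκ := fun i => PrivOpt.kappa_integral_le (lam := lam) (β := n * β) (P := P) hC hnα hnβ hu
    (Z := Z i) ((PrivOpt.measurable_Phi_noise e (hη i)).norm.div_const _) (hZ0 i)
    (by
      simp only [hZsq]
      exact (PrivOpt.integrable_norm_Phi_sq e (hγ i) (hp i).1 (hη i) (hlaw i)).div_const 2)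
    (v := γ i * √(riemannZeta ((2 * p i : ℝ) : ℂ)).re)
    (mul_nonneg (hγ i).le (Real.sqrt_nonneg _))
    (by
      simp only [hZsq]
      rw [integral_div, PrivOpt.integral_norm_Phi_sq e (hγ i) (hp i).1 (hη i) (hlaw i), mul_pow,
        Real.sq_sqrt (hζ i)]
      exact le_of_eq (by ring))
  have hsum : ∀ i, Integrable (fun ω => PrivOpt.kappa D lam u (n * α) (n * β) (Z i ω) +
      PrivOpt.kappa D lam u (n * α) (n * β) (ε i)) P := fun i =>
    (hκ i).1.add (integrable_const _)
  have hpoint : ∀ ω, ‖a (F ω) - a f‖ ≤ ∑ i, (PrivOpt.kappa D lam u (n * α) (n * β) (Z i ω) +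
      PrivOpt.kappa D lam u (n * α) (n * β) (ε i)) := by
    intro ω
    refine (hstab lam hlam f (F ω) hfS (hFS ω)).trans (Finset.sum_le_sum fun i _ => ?_)
    refine le_trans ?_ (PrivOpt.kappa_add_le hC hnα hnβ hu (hZ0 i ω) (hε i))
    refine PrivOpt.kappa_mono hC hnα hnβ hu (by positivity) ?_
    -- For the smoothing error the gain of `1/√2` is simply given up.
    have h2 : 1 ≤ √(2 : ℝ) := Real.one_le_sqrt.2 one_le_two
    calc ‖F ω i - f i‖ / √2 ≤ (‖PrivOpt.Phi e fun k => η i k ω‖ + ε i) / √2 := by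
          gcongr
          exact hdist ω i
      _ = Z i ω + ε i / √2 := add_div _ _ _
      _ ≤ Z i ω + ε i := by
          gcongr
          exact div_le_self (hε i) h2
  calc ∫ ω, ‖a (F ω) - a f‖ ∂P
      ≤ ∫ ω, ∑ i, (PrivOpt.kappa D lam u (n * α) (n * β) (Z i ω) +
          PrivOpt.kappa D lam u (n * α) (n * β) (ε i)) ∂P :=
        integral_mono hint (integrable_finsetSum _ fun i _ => hsum i) hpoint
    _ = ∑ i, (∫ ω, PrivOpt.kappa D lam u (n * α) (n * β) (Z i ω) ∂P +
          PrivOpt.kappa D lam u (n * α) (n * β) (ε i)) := by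
        rw [integral_finsetSum _ fun i _ => hsum i]
        refine Finset.sum_congr rfl fun i _ => ?_
        rw [integral_add (hκ i).1 (integrable_const _)]
        simp
    _ ≤ _ := Finset.sum_le_sum fun i _ => add_le_add (hκ i).2 le_rfl
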